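/- Let $\mathscr{G}_\star$ be the space of connected locally finite rooted graphs modulo rooted isomorphism, with the metric $$\mathbf d\big((G_1,\rho_1),(G_2,\rho_2)\big)=\inf\Big\{\tfrac1{1+R}: R\in\mathbb Z_{\ge 0},\ B_R(\rho_1;G_1)\cong B_R(\rho_2;G_2)\Big\},$$ where $B_R(\rho;G)$ is the subgraph of $G$ induced by the vertices at distance at most $R$ from $\rho$, rooted at $\rho$. A sequence of finite nonempty graphs $G_n=(V_n,E_n)$ converges locally weakly to a random element $(G,\rho)$ of $\mathscr{G}_\star$ if, for $U_n$ a uniformly random vertex of $G_n$, the connected component of $U_n$ in $G_n$, rooted at $U_n$, converges in law to $(G,\rho)$ in $\mathscr{G}_\star$. For a finite graph $H=(V,E)$ and $0<\delta\le 1/2$ let $$h_\delta(H)=\min\Big\{\frac{|E_H(A,V\setminus A)|}{|A|}: A\subseteq V,\ \delta\le\frac{|A|}{|V|}\le\frac12\Big\}\qquad(\min\emptyset=+\infty),$$ where $E_H(A,B)$ is the set of edges between $A$ and $B$; the sequence $G_n$ is expanding if $\liminf_{n\to\infty}h_\delta(G_n)>0$ for every $0<\delta\le1/2$. For a graph $G$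 let $$p_c(G)=\sup\big\{p\in[0,1]:\ \mathbb P_p(\omega\text{ has no infinite component})=1\big\},$$ where under $\mathbb P_p$ the random subgraph $\omega$ retains each edge of $G$ independently with probability $p$. Let $G_n$ be an expanding sequence of finite graphs that converges locally weakly to the random rooted graph $(G,\rho)$, and suppose that for some $d<\infty$ every $G_n$ has average degree at most $d$. Then $p_c(G)$ is almost surely constant: there is a constant $c$ such that $p_c(G)=c$ almost surely. -/

import Mathlib

open MeasureTheory ProbabilityTheory Filter Topology
open scoped ENNReal unitInterval

universe u

/-- A connected locally finite graph with a distinguished vertex, the root. -/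
structure RootedGraph : Type (u + 1) where
  V : Type u
  graph : SimpleGraph V
  root : V
  connected : graph.Connected
  locallyFinite : ∀ v, (graph.neighborSet v).Finite

namespace RootedGraph

/-- Rooted isomorphism: a graph isomorphism that maps the root to the root. -/
def Isomorphic (x y : RootedGraph.{u}) : Prop :=
  ∃ φ : x.graph ≃g y.graph, φ x.root = y.root

instance setoid : Setoid RootedGraph.{u} where
  r := Isomorphic
  iseqv :=
    { refl := fun _ => ⟨SimpleGraph.Iso.refl, rfl⟩
      symm := fun ⟨φ, h⟩ => ⟨φ.symm, by rw [← h]; simp⟩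
      trans := fun ⟨φ, h⟩ ⟨ψ, k⟩ => ⟨ψ.comp φ, by simp [h, k]⟩ }

/-- The vertices at graph distance at most `R` from the root. -/
def ball (x : RootedGraph.{u}) (R : ℕ) : Set x.V := {v | x.graph.dist x.root v ≤ R}

lemma root_mem_ball (x : RootedGraph.{u}) (R : ℕ) : x.root ∈ x.ball R := by simp [ball]

/-- The `R`-balls around the roots, as rooted induced subgraphs, are isomorphic. -/
def BallIso (R : ℕ) (x y : RootedGraph.{u}) : Prop :=
  ∃ φ : x.graph.induce (x.ball R) ≃g y.graph.induce (y.ball R),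
    φ ⟨x.root, x.root_mem_ball R⟩ = ⟨y.root, y.root_mem_ball R⟩

lemma BallIso.symm {R : ℕ} {x y : RootedGraph.{u}} (h : BallIso R x y) : BallIso R y x := by
  obtain ⟨φ, h⟩ := h
  exact ⟨φ.symm, by rw [← h]; simp⟩

lemma BallIso.trans {R : ℕ} {x y z : RootedGraph.{u}} (h : BallIso R x y) (k : BallIso R y z) :
    BallIso R x z := by
  obtain ⟨φ, h⟩ := h
  obtain ⟨ψ, k⟩ := k
  exact ⟨ψ.comp φ, by simp [h, k]⟩

lemma dist_le_of_ballIso {R : ℕ} {x y : RootedGraph.{u}}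
    (φ : x.graph.induce (x.ball R) ≃g y.graph.induce (y.ball R))
    (h : φ ⟨x.root, x.root_mem_ball R⟩ = ⟨y.root, y.root_mem_ball R⟩) (w : x.ball R) :
    y.graph.dist y.root (φ w) ≤ x.graph.dist x.root w := by
  classical
  obtain ⟨p, hp⟩ := x.connected.exists_walk_length_eq_dist x.root w
  have hs : ∀ v ∈ p.support, v ∈ x.ball R := fun v hv =>
    (SimpleGraph.dist_le (p.takeUntil v hv)).trans
      ((p.length_takeUntil_le_length hv).trans (hp.le.trans w.2))
  let q := ((p.induce (x.ball R) hs).map φ.toHom).map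
    (SimpleGraph.Embedding.induce (G := y.graph) (y.ball R)).toHom
  have hq : q.length = p.length := by
    have := congrArg SimpleGraph.Walk.length (SimpleGraph.Walk.map_induce p hs)
    simp only [SimpleGraph.Walk.length_map] at this
    exact (SimpleGraph.Walk.length_map _ _).trans ((SimpleGraph.Walk.length_map _ _).trans this)
  rw [← hp, ← hq]
  have hr : ((φ ⟨x.root, x.root_mem_ball R⟩ : y.ball R) : y.V) = y.root := by rw [h]
  rw [← hr]
  exact SimpleGraph.dist_le q

lemma BallIso.mono {r R : ℕ} (hr : r ≤ R) {x y : RootedGraph.{u}} (h : BallIso R x y) :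
    BallIso r x y := by
  obtain ⟨φ, h⟩ := h
  have h' : φ.symm ⟨y.root, y.root_mem_ball R⟩ = ⟨x.root, x.root_mem_ball R⟩ := by
    rw [← h]; simp
  have hx : ∀ v, v ∈ x.ball r → v ∈ x.ball R := fun v hv => le_trans hv hr
  have hy : ∀ v, v ∈ y.ball r → v ∈ y.ball R := fun v hv => le_trans hv hr
  refine ⟨⟨⟨fun w => ⟨φ ⟨w, hx _ w.2⟩, (dist_le_of_ballIso φ h _).trans w.2⟩,
    fun w => ⟨φ.symm ⟨w, hy _ w.2⟩, (dist_le_of_ballIso φ.symm h' _).trans w.2⟩,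
    fun w => by simp, fun w => by simp⟩, ?_⟩, ?_⟩
  · intro a b
    exact φ.map_rel_iff (a := ⟨a, hx _ a.2⟩) (b := ⟨b, hx _ b.2⟩)
  · apply Subtype.ext
    have h2 : ((φ ⟨x.root, x.root_mem_ball R⟩ : y.ball R) : y.V) = y.root := by rw [h]
    exact h2

lemma Isomorphic.ballIso {x y : RootedGraph.{u}} (h : Isomorphic x y) (R : ℕ) :
    BallIso R x y := by
  obtain ⟨φ, h⟩ := h
  have key : ∀ v, y.graph.dist y.root (φ v) = x.graph.dist x.root v := by
    intro v
    rw [← h]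
    apply le_antisymm
    · obtain ⟨p, hp⟩ := x.connected.exists_walk_length_eq_dist x.root v
      rw [← hp, ← SimpleGraph.Walk.length_map φ.toHom p]
      exact SimpleGraph.dist_le _
    · obtain ⟨p, hp⟩ := y.connected.exists_walk_length_eq_dist (φ x.root) (φ v)
      rw [← hp, ← SimpleGraph.Walk.length_map φ.symm.toHom p]
      have := SimpleGraph.dist_le (p.map φ.symm.toHom)
      simpa using this
  refine ⟨⟨⟨fun w => ⟨φ w, (key _).le.trans w.2⟩,
    fun w => ⟨φ.symm w, ?_⟩, fun w => by simp, fun w => by simp⟩, ?_⟩, ?_⟩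
  · have := key (φ.symm w)
    rw [φ.apply_symm_apply] at this
    exact this.symm.le.trans w.2
  · intro a b
    exact φ.map_rel_iff
  · exact Subtype.ext h

/-- `inf {1 / (1 + R) : R ≥ 0, the R-balls around the roots are isomorphic}`. -/
noncomputable def localDist (x y : RootedGraph.{u}) : ℝ :=
  sInf {r : ℝ | ∃ R : ℕ, BallIso R x y ∧ r = 1 / (1 + R)}

lemma ballIso_zero (x y : RootedGraph.{u}) : BallIso 0 x y := by
  have hx : ∀ w : x.ball 0, (w : x.V) = x.root := fun w =>
    (x.connected.dist_eq_zero_iff.1 (Nat.le_zero.1 w.2)).symm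
  have hy : ∀ w : y.ball 0, (w : y.V) = y.root := fun w =>
    (y.connected.dist_eq_zero_iff.1 (Nat.le_zero.1 w.2)).symm
  refine ⟨⟨⟨fun _ => ⟨y.root, y.root_mem_ball 0⟩, fun _ => ⟨x.root, x.root_mem_ball 0⟩,
    fun w => Subtype.ext (hx w).symm, fun w => Subtype.ext (hy w).symm⟩, ?_⟩, rfl⟩
  intro a b
  simp [hx a, hx b]

lemma localDist_bddBelow (x y : RootedGraph.{u}) :
    BddBelow {r : ℝ | ∃ R : ℕ, BallIso R x y ∧ r = 1 / (1 + R)} :=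
  ⟨0, by rintro _ ⟨R, -, rfl⟩; positivity⟩

lemma localDist_self (x : RootedGraph.{u}) : localDist x x = 0 := by
  apply le_antisymm
  · apply le_of_forall_pos_le_add
    intro ε hε
    obtain ⟨R, hR⟩ := exists_nat_one_div_lt hε
    refine (csInf_le (localDist_bddBelow x x)
      ⟨R, Isomorphic.ballIso (Setoid.refl x) R, rfl⟩).trans ?_
    rw [zero_add, add_comm]
    exact hR.le
  · exact Real.sInf_nonneg (by rintro _ ⟨R, -, rfl⟩; positivity)

lemma localDist_comm (x y : RootedGraph.{u}) : localDist x y = localDist y x := by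
  unfold localDist
  congr 1
  ext r
  exact ⟨fun ⟨R, h, k⟩ => ⟨R, h.symm, k⟩, fun ⟨R, h, k⟩ => ⟨R, h.symm, k⟩⟩

lemma localDist_triangle (x y z : RootedGraph.{u}) :
    localDist x z ≤ localDist x y + localDist y z := by
  apply le_of_forall_pos_le_add
  intro ε hε
  obtain ⟨_, ⟨R, hR, rfl⟩, h1⟩ := exists_lt_of_csInf_lt
    (s := {r : ℝ | ∃ R : ℕ, BallIso R x y ∧ r = 1 / (1 + R)})
    ⟨_, 0, ballIso_zero x y, rfl⟩
    (lt_add_of_pos_right (localDist x y) (half_pos hε))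
  obtain ⟨_, ⟨S, hS, rfl⟩, h2⟩ := exists_lt_of_csInf_lt
    (s := {r : ℝ | ∃ R : ℕ, BallIso R y z ∧ r = 1 / (1 + R)})
    ⟨_, 0, ballIso_zero y z, rfl⟩
    (lt_add_of_pos_right (localDist y z) (half_pos hε))
  have h3 : localDist x z ≤ 1 / (1 + ((min R S : ℕ) : ℝ)) :=
    csInf_le (localDist_bddBelow x z)
      ⟨_, (hR.mono (min_le_left R S)).trans (hS.mono (min_le_right R S)), rfl⟩
  have h4 : (0 : ℝ) < 1 / (1 + (R : ℝ)) := by positivity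
  have h5 : (0 : ℝ) < 1 / (1 + (S : ℝ)) := by positivity
  rcases min_choice R S with h | h <;> rw [h] at h3 <;> linarith

lemma localDist_congr {x y x' y' : RootedGraph.{u}} (h : x ≈ x') (k : y ≈ y') :
    localDist x y = localDist x' y' := by
  unfold localDist
  congr 1
  ext r
  refine exists_congr fun R => and_congr_left fun _ => ⟨fun e => ?_, fun e => ?_⟩
  · exact (Isomorphic.ballIso (Setoid.symm h) R).trans (e.trans (Isomorphic.ballIso k R))
  · exact (Isomorphic.ballIso h R).trans (e.trans (Isomorphic.ballIso (Setoid.symm k) R))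

end RootedGraph

/-- The space of connected locally finite rooted graphs modulo rooted isomorphism. -/
def GStar : Type (u + 1) := Quotient RootedGraph.setoid.{u}

namespace GStar

noncomputable instance : PseudoMetricSpace GStar.{u} where
  dist := Quotient.lift₂ RootedGraph.localDist
    (fun _ _ _ _ h k => RootedGraph.localDist_congr h k)
  dist_self := by rintro ⟨x⟩; exact x.localDist_self
  dist_comm := by rintro ⟨x⟩ ⟨y⟩; exact x.localDist_comm y
  dist_triangle := by rintro ⟨x⟩ ⟨y⟩ ⟨z⟩; exact x.localDist_triangle y z

noncomputable instance : MeasurableSpace GStar.{u} := borel _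

instance : BorelSpace GStar.{u} := ⟨rfl⟩

end GStar

/-- The connected component of `v` in a finite graph, rooted at `v`, as an element of `GStar`. -/
def SimpleGraph.rootedAt {V : Type u} [Finite V] (G : SimpleGraph V) (v : V) : GStar.{u} :=
  Quotient.mk _
    { V := G.connectedComponentMk v
      graph := (G.connectedComponentMk v).toSimpleGraph
      root := ⟨v, rfl⟩
      connected := (G.connectedComponentMk v).connected_toSimpleGraph
      locallyFinite := fun _ => Set.toFinite _ }

/-- The law of `(G, U)` with `U` a uniformly random vertex of the finite graph `G`. -/
noncomputable def SimpleGraph.localLaw {V : Type u} [Fintype V] [Nonempty V]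
    (G : SimpleGraph V) : ProbabilityMeasure GStar.{u} :=
  ⟨((PMF.uniformOfFintype V).map G.rootedAt).toMeasure, inferInstance⟩

/-- Local weak convergence of a sequence of finite graphs to a random rooted graph of law `μ`:
convergence in law of `(G n, U n)` in the space `GStar`. -/
def LocallyWeaklyConverges {V : ℕ → Type u} [∀ n, Fintype (V n)] [∀ n, Nonempty (V n)]
    (G : ∀ n, SimpleGraph (V n)) (μ : ProbabilityMeasure GStar.{u}) : Prop :=
  Tendsto (fun n => (G n).localLaw) atTop (𝓝 μ)

open Classical in
/-- `h_δ(G)`: the minimum of `|E(A, Aᶜ)| / |A|` over all sets `A` of vertices such that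
`δ ≤ |A| / |V| ≤ 1 / 2` (and `∞` if there is no such set). -/
noncomputable def SimpleGraph.expansion {V : Type u} [Fintype V] (G : SimpleGraph V) (δ : ℝ) :
    ℝ≥0∞ :=
  ⨅ (A : Finset V) (_ : δ ≤ (A.card : ℝ) / Fintype.card V ∧
      (A.card : ℝ) / Fintype.card V ≤ 1 / 2),
    ((G.interedges A Aᶜ).card : ℝ≥0∞) / (A.card : ℝ≥0∞)

/-- Expanding sequences of finite graphs. -/
def IsExpanding {V : ℕ → Type u} [∀ n, Fintype (V n)] (G : ∀ n, SimpleGraph (V n)) : Prop :=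
  ∀ δ : ℝ, 0 < δ → δ ≤ 1 / 2 → 0 < liminf (fun n => (G n).expansion δ) atTop

open Classical in
/-- The average degree of a finite graph. -/
noncomputable def SimpleGraph.averageDegree {V : Type u} [Fintype V] (G : SimpleGraph V) : ℝ :=
  (∑ v, (G.degree v : ℝ)) / Fintype.card V

/-- All connected components of the graph are finite. -/
def SimpleGraph.NoInfiniteComponent {V : Type u} (G : SimpleGraph V) : Prop :=
  ∀ C : G.ConnectedComponent, C.supp.Finite

/-- The critical probability for Bernoulli bond percolation on `G`: every edge of `G` is open
with probability `p`, independently, and `ω` is the random set of open edges. -/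
noncomputable def SimpleGraph.criticalProbability {V : Type u} (G : SimpleGraph V) : ℝ :=
  sSup ((fun p : I => (p : ℝ)) '' {p : I | ∀ᵐ ω ∂setBer(G.edgeSet, p),
    (SimpleGraph.fromEdgeSet ω).NoInfiniteComponent})

lemma SimpleGraph.NoInfiniteComponent.iso {V W : Type u} {G : SimpleGraph V} {H : SimpleGraph W}
    (φ : G ≃g H) (h : G.NoInfiniteComponent) : H.NoInfiniteComponent := by
  intro C
  induction C using SimpleGraph.ConnectedComponent.ind with
  | h w =>
    refine ((h (G.connectedComponentMk (φ.symm w))).image φ).subset ?_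
    intro v hv
    refine ⟨φ.symm v, ?_, by simp⟩
    rw [SimpleGraph.ConnectedComponent.mem_supp_iff, SimpleGraph.ConnectedComponent.eq] at hv ⊢
    exact hv.map φ.symm.toHom

lemma setBernoulli_map_equiv {ι κ : Type u} (e : ι ≃ κ) (s : Set ι) (t : Set κ)
    (h : ∀ i, e i ∈ t ↔ i ∈ s) (p : I) :
    setBer(t, p) = (setBer(s, p)).map (fun ω => e.symm ⁻¹' ω) := by
  have hm : Measurable (fun f : ι → Prop => {i | f i}) :=
    MeasurableEquiv.setOfPred.measurable
  have hm' : Measurable (fun f : κ → Prop => {i | f i}) :=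
    MeasurableEquiv.setOfPred.measurable
  have hpre : Measurable (fun ω : Set ι => e.symm ⁻¹' ω) := by
    have : (fun ω : Set ι => e.symm ⁻¹' ω) =
        (fun f : κ → Prop => {i | f i}) ∘ (fun (f : ι → Prop) (j : κ) => f (e.symm j)) ∘
          (fun (ω : Set ι) i => i ∈ ω) := rfl
    rw [this]
    exact hm'.comp ((measurable_pi_lambda _ fun j => measurable_pi_apply _).comp
      MeasurableEquiv.setOfPred.symm.measurable)
  rw [setBernoulli_eq_map, setBernoulli_eq_map, Measure.map_map hpre hm,
    ← Measure.infinitePi_map_piCongrLeft _ e, Measure.map_map hm' (by fun_prop)]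
  congr 1
  · funext f
    ext j
    obtain ⟨i, rfl⟩ := e.surjective j
    simp [MeasurableEquiv.coe_piCongrLeft, Equiv.piCongrLeft_apply_apply]
  · simp only [h]

lemma SimpleGraph.criticalProbability_iso {V W : Type u} {G : SimpleGraph V} {H : SimpleGraph W}
    (φ : G ≃g H) : G.criticalProbability = H.criticalProbability := by
  have key : ∀ {V W : Type u} {G : SimpleGraph V} {H : SimpleGraph W} (φ : G ≃g H) (p : I),
      (∀ᵐ ω ∂setBer(H.edgeSet, p), (SimpleGraph.fromEdgeSet ω).NoInfiniteComponent) →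
      ∀ᵐ ω ∂setBer(G.edgeSet, p), (SimpleGraph.fromEdgeSet ω).NoInfiniteComponent := by
    intro V W G H φ p hp
    let e : Sym2 V ≃ Sym2 W :=
      ⟨Sym2.map φ, Sym2.map φ.symm, fun z => by simp [Sym2.map_map],
        fun z => by simp [Sym2.map_map]⟩
    have he : ∀ i, e i ∈ H.edgeSet ↔ i ∈ G.edgeSet := by
      intro i
      induction i using Sym2.ind with
      | _ a b => exact φ.map_rel_iff
    rw [setBernoulli_map_equiv e G.edgeSet H.edgeSet he p] at hp
    have hne : (setBer(G.edgeSet, p)).map (fun ω => e.symm ⁻¹' ω) ≠ 0 := by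
      rw [← setBernoulli_map_equiv e G.edgeSet H.edgeSet he p]
      exact IsProbabilityMeasure.ne_zero _
    filter_upwards [ae_of_ae_map (AEMeasurable.of_map_ne_zero hne) hp] with ω hω
    refine hω.iso ⟨φ.toEquiv.symm, ?_⟩
    intro a b
    simp only [SimpleGraph.fromEdgeSet_adj, Set.mem_preimage]
    exact and_congr Iff.rfl φ.toEquiv.symm.injective.ne_iff
  unfold SimpleGraph.criticalProbability
  congr 2
  ext p
  exact ⟨key φ.symm p, key φ p⟩

/-- The critical probability as a function on `GStar`. -/
noncomputable def GStar.criticalProbability : GStar.{u} → ℝ :=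
  Quotient.lift (fun x : RootedGraph.{u} => x.graph.criticalProbability)
    (fun _ _ ⟨φ, _⟩ => SimpleGraph.criticalProbability_iso φ)

/-!
The critical probability does not change when the root is moved, so it suffices that the law `μ` of
the limit is ergodic: a Borel set `A` of rooted graphs that is closed under moving the root to a
neighbour has probability zero or one (`zero_one_of_isRerootInvariant`).

Suppose `0 < μ A < 1`. Approximate `A` by a set `B` that depends only on a ball of fixed radius
around the root. In the finite graph `G n`, the vertices whose rooted component lies in `B` form a
set whose density is bounded away from `0` and `1`, so by expansion the number of edges that leave
it is at least a fixed multiple of the number of vertices. The number of these edges per vertex is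
the average of a local function, and thus converges to the expected number of edges from the root,
if it is in `B`, to neighbours outside `B` (`LocallyWeaklyConverges.mul_le_lintegral_boundary`). But
as `A` is invariant, such an edge starts outside `A` or ends in `A \ B`, and both are rare if `B`
is close to `A`.

Two points need care, as the degrees in `G n` are bounded only on average. By Fatou's lemma
the root of the limit has finite expected degree, so `A` can be approximated with respect to the
measure biased by the degree; this controls the edges that start in a small set. The edges that end
in a small set are controlled by the mass transport inequality
`LocallyWeaklyConverges.lintegral_nbrCount_le`: it holds for local sets by double counting in `G n`,
and for open sets by monotone convergence. Hence `B` is built from an open set `U ⊇ A` such that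
`U \ A` is small: an open set is an increasing union of local sets `localInterior U R`, which makes
`U \ B` both small and open. Finally, the vertices of large degree are removed from `B`, so that
the function that counts the edges leaving `B` is bounded; the same inequality shows that this adds
few edges.

The critical probability is a Borel function (`GStar.measurable_criticalProbability`) because
percolation at `p` has no infinite component if and only if, for every `S`, the probability of an
open self-avoiding path of length `n` from the ball of radius `S` tends to zero, and this
probability depends only on the ball of radius `S + n`. Monotonicity in `p` reduces the supremum in
the definition to rational `p`.
-/

/-! ### Re-rooting and isomorphisms of balls -/

namespace RootedGraph

/-- The same graph with another root. -/
@[simps] def reroot (x : RootedGraph.{u}) (v : x.V) : RootedGraph.{u} where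
  V := x.V
  graph := x.graph
  root := v
  connected := x.connected
  locallyFinite := x.locallyFinite

/-- The class of a rooted graph in `GStar`. -/
def toGStar (x : RootedGraph.{u}) : GStar.{u} := Quotient.mk _ x

lemma toGStar_eq_of_isomorphic {x y : RootedGraph.{u}} (h : Isomorphic x y) :
    x.toGStar = y.toGStar := Quotient.sound h

lemma toGStar_surjective : Function.Surjective toGStar.{u} := Quotient.exists_rep

lemma BallIso.refl (R : ℕ) (x : RootedGraph.{u}) : BallIso R x x :=
  Isomorphic.ballIso (Setoid.refl x) R

lemma ballIso_of_dist_lt {R : ℕ} {x y : RootedGraph.{u}}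
    (h : dist x.toGStar y.toGStar < 1 / (1 + R)) : BallIso R x y := by
  obtain ⟨_, ⟨S, hS, rfl⟩, h1⟩ := exists_lt_of_csInf_lt
    (s := {r : ℝ | ∃ R : ℕ, BallIso R x y ∧ r = 1 / (1 + R)}) ⟨_, 0, ballIso_zero x y, rfl⟩ h
  refine hS.mono ?_
  have h2 := lt_of_one_div_lt_one_div (by positivity) h1
  exact_mod_cast (lt_of_add_lt_add_left h2).le

lemma dist_toGStar_le {R : ℕ} {x y : RootedGraph.{u}} (h : BallIso R x y) :
    dist x.toGStar y.toGStar ≤ 1 / (1 + R) :=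
  csInf_le (localDist_bddBelow x y) ⟨R, h, rfl⟩

/-- An isomorphism of balls does not increase the distance between two vertices, provided that
all vertices at most that far from the first one are in the ball. -/
lemma dist_le_of_induce_iso {x y : RootedGraph.{u}} {s : Set x.V} {t : Set y.V}
    (φ : x.graph.induce s ≃g y.graph.induce t) (v w : s)
    (hs : ∀ z, x.graph.dist v z ≤ x.graph.dist v w → z ∈ s) :
    y.graph.dist (φ v) (φ w) ≤ x.graph.dist v w := by
  classical
  obtain ⟨p, hp⟩ := x.connected.exists_walk_length_eq_dist v w
  have hs : ∀ z ∈ p.support, z ∈ s := fun z hz => hs z <|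
    (SimpleGraph.dist_le (p.takeUntil z hz)).trans
      ((p.length_takeUntil_le_length hz).trans hp.le)
  let q := ((p.induce s hs).map φ.toHom).map
    (SimpleGraph.Embedding.induce (G := y.graph) t).toHom
  have hq : q.length = p.length := by
    have := congrArg SimpleGraph.Walk.length (SimpleGraph.Walk.map_induce p hs)
    simp only [SimpleGraph.Walk.length_map] at this
    exact (SimpleGraph.Walk.length_map _ _).trans ((SimpleGraph.Walk.length_map _ _).trans this)
  rw [← hp, ← hq]
  exact SimpleGraph.dist_le q

lemma mem_ball_succ_of_adj {R : ℕ} {x : RootedGraph.{u}} {v z : x.V}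
    (hv : x.graph.Adj x.root v) (hz : x.graph.dist v z ≤ R) : z ∈ x.ball (R + 1) := by
  have h1 : x.graph.dist x.root v = 1 := SimpleGraph.dist_eq_one_iff_adj.2 hv
  have h2 := x.connected.dist_triangle (u := x.root) (v := v) (w := z)
  simp only [ball, Set.mem_ofPred_eq]
  omega

lemma ballIso_reroot {R : ℕ} {x y : RootedGraph.{u}}
    (φ : x.graph.induce (x.ball (R + 1)) ≃g y.graph.induce (y.ball (R + 1)))
    {v : x.ball (R + 1)} (hv : x.graph.Adj x.root v) (hv' : y.graph.Adj y.root (φ v)) :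
    BallIso R (x.reroot v) (y.reroot (φ v)) := by
  have hx : ∀ z, z ∈ (x.reroot v).ball R → z ∈ x.ball (R + 1) :=
    fun z hz => mem_ball_succ_of_adj hv hz
  have hy : ∀ z, z ∈ (y.reroot (φ v)).ball R → z ∈ y.ball (R + 1) :=
    fun z hz => mem_ball_succ_of_adj hv' hz
  have h1 : ∀ (w : x.V) (hw : w ∈ (x.reroot v).ball R),
      y.graph.dist (φ v) (φ ⟨w, hx w hw⟩) ≤ R := fun w hw =>
    (dist_le_of_induce_iso φ v ⟨w, hx w hw⟩ fun z hz => hx z (hz.trans hw)).trans hw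
  have h2 : ∀ (w : y.V) (hw : w ∈ (y.reroot (φ v)).ball R),
      x.graph.dist v (φ.symm ⟨w, hy w hw⟩) ≤ R := fun w hw => by
    have := (dist_le_of_induce_iso φ.symm (φ v) ⟨w, hy w hw⟩
      fun z hz => hy z (hz.trans hw)).trans hw
    rwa [φ.symm_apply_apply] at this
  refine ⟨⟨⟨fun w => ⟨(φ ⟨w.1, hx w.1 w.2⟩).1, h1 w.1 w.2⟩,
    fun w => ⟨(φ.symm ⟨w.1, hy w.1 w.2⟩).1, h2 w.1 w.2⟩,
    fun w => by simp, fun w => by simp⟩, ?_⟩, rfl⟩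
  intro a b
  exact φ.map_rel_iff (a := ⟨a.1, hx _ a.2⟩) (b := ⟨b.1, hx _ b.2⟩)

lemma adj_root_iff_of_ballIso {R : ℕ} {x y : RootedGraph.{u}}
    (φ : x.graph.induce (x.ball R) ≃g y.graph.induce (y.ball R))
    (h : φ ⟨x.root, x.root_mem_ball R⟩ = ⟨y.root, y.root_mem_ball R⟩) (v : x.ball R) :
    y.graph.Adj y.root (φ v) ↔ x.graph.Adj x.root v := by
  have := φ.map_rel_iff (a := ⟨x.root, x.root_mem_ball R⟩) (b := v)
  rw [h] at this
  exact this

lemma finite_ball (x : RootedGraph.{u}) (R : ℕ) : (x.ball R).Finite := by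
  induction R with
  | zero =>
    refine (Set.finite_singleton x.root).subset fun v hv => ?_
    exact (x.connected.dist_eq_zero_iff.1 (Nat.le_zero.1 hv)).symm
  | succ R ih =>
    refine (ih.union (ih.biUnion fun v _ => x.locallyFinite v)).subset fun v hv => ?_
    by_cases h : v ∈ x.ball R
    · exact Or.inl h
    right
    obtain ⟨p, hp⟩ := x.connected.exists_walk_length_eq_dist x.root v
    have hl : p.length = R + 1 := by
      simp only [ball, Set.mem_ofPred_eq] at hv h
      omega
    have hnil : ¬ p.Nil := by
      intro hn
      rw [← SimpleGraph.Walk.length_eq_zero_iff] at hn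
      omega
    refine Set.mem_biUnion (x := p.penultimate) ?_ (p.adj_penultimate hnil)
    have := SimpleGraph.dist_le p.dropLast
    rw [SimpleGraph.Walk.length_dropLast] at this
    simp only [ball, Set.mem_ofPred_eq]
    omega

lemma countable_V (x : RootedGraph.{u}) : Countable x.V := by
  rw [← Set.countable_univ_iff]
  refine (Set.countable_iUnion fun R => (x.finite_ball R).countable).mono fun v _ => ?_
  exact Set.mem_iUnion.2 ⟨_, le_refl (x.graph.dist x.root v)⟩

end RootedGraph

namespace GStar

open RootedGraph

/-! ### Local functions and open sets -/

/-- The value of `f` depends only on the isomorphism class of the `R`-ball around the root. -/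
def IsLocal {α : Type*} (R : ℕ) (f : GStar.{u} → α) : Prop :=
  ∀ x y : RootedGraph.{u}, BallIso R x y → f x.toGStar = f y.toGStar

lemma IsLocal.isLocallyConstant {α : Type*} {R : ℕ} {f : GStar.{u} → α} (hf : IsLocal R f) :
    IsLocallyConstant f := by
  rw [IsLocallyConstant.iff_exists_open]
  intro x
  obtain ⟨x, rfl⟩ := toGStar_surjective x
  refine ⟨Metric.ball x.toGStar (1 / (1 + R)), Metric.isOpen_ball,
    Metric.mem_ball_self (by positivity), fun y hy => ?_⟩
  obtain ⟨y, rfl⟩ := toGStar_surjective y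
  exact hf _ _ (ballIso_of_dist_lt hy)

lemma IsLocal.continuous {α : Type*} [TopologicalSpace α] {R : ℕ} {f : GStar.{u} → α}
    (hf : IsLocal R f) : Continuous f := hf.isLocallyConstant.continuous

lemma IsLocal.comp {α β : Type*} {R : ℕ} {f : GStar.{u} → α} (hf : IsLocal R f) (g : α → β) :
    IsLocal R (fun x => g (f x)) := fun x y hxy => congrArg g (hf x y hxy)

lemma IsLocal.comp₂ {α β γ : Type*} {R S : ℕ} {f : GStar.{u} → α} {g : GStar.{u} → β}
    (hf : IsLocal R f) (hg : IsLocal S g) (k : α → β → γ) :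
    IsLocal (max R S) (fun x => k (f x) (g x)) := fun x y hxy => by
  simp only [hf x y (hxy.mono (le_max_left _ _)), hg x y (hxy.mono (le_max_right _ _))]

/-- A set determined by the `R`-ball around the root. -/
abbrev IsLocalSet (R : ℕ) (B : Set GStar.{u}) : Prop := IsLocal R (· ∈ B)

lemma IsLocalSet.isClopen {R : ℕ} {B : Set GStar.{u}} (hB : IsLocalSet R B) : IsClopen B := by
  have h := hB.isLocallyConstant.isClopen_fiber True
  simpa using h

lemma IsLocalSet.measurableSet {R : ℕ} {B : Set GStar.{u}} (hB : IsLocalSet R B) :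
    MeasurableSet B := hB.isClopen.isOpen.measurableSet

lemma IsLocalSet.compl {R : ℕ} {B : Set GStar.{u}} (hB : IsLocalSet R B) : IsLocalSet R Bᶜ :=
  IsLocal.comp hB Not

lemma IsLocalSet.inter {R S : ℕ} {B C : Set GStar.{u}} (hB : IsLocalSet R B)
    (hC : IsLocalSet S C) : IsLocalSet (max R S) (B ∩ C) := IsLocal.comp₂ hB hC And

lemma isLocalSet_univ : IsLocalSet 0 (Set.univ : Set GStar.{u}) := fun _ _ _ => by simp

/-- The largest subset of `U` that is determined by the `R`-ball around the root. -/
def localInterior (U : Set GStar.{u}) (R : ℕ) : Set GStar.{u} :=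
  {z | ∀ x y : RootedGraph.{u}, x.toGStar = z → BallIso R x y → y.toGStar ∈ U}

lemma isLocalSet_localInterior (U : Set GStar.{u}) (R : ℕ) :
    IsLocalSet R (localInterior U R) := by
  have key : ∀ x y : RootedGraph.{u}, BallIso R x y → x.toGStar ∈ localInterior U R →
      y.toGStar ∈ localInterior U R := by
    intro x y hxy hx y' z hy hz
    have hy : BallIso R y y' :=
      Isomorphic.ballIso (Setoid.symm (Quotient.exact hy)) R
    exact hx x z rfl ((hxy.trans hy).trans hz)
  exact fun x y hxy => propext ⟨key x y hxy, key y x hxy.symm⟩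

lemma localInterior_subset (U : Set GStar.{u}) (R : ℕ) : localInterior U R ⊆ U := by
  intro z hz
  obtain ⟨x, rfl⟩ := toGStar_surjective z
  exact hz x x rfl (BallIso.refl R x)

lemma monotone_localInterior (U : Set GStar.{u}) : Monotone (localInterior U) :=
  fun _ _ h _ hz x y hx hxy => hz x y hx (hxy.mono h)

/-- An open set is the increasing union of the local sets that it contains. -/
lemma iUnion_localInterior {U : Set GStar.{u}} (hU : IsOpen U) :
    ⋃ R, localInterior U R = U := by
  refine (Set.iUnion_subset fun R => localInterior_subset U R).antisymm fun z hz => ?_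
  obtain ⟨ε, hε, h⟩ := Metric.isOpen_iff.1 hU z hz
  obtain ⟨R, hR⟩ := exists_nat_one_div_lt hε
  refine Set.mem_iUnion.2 ⟨R, fun x y hx hxy => h ?_⟩
  rw [Metric.mem_ball', ← hx]
  refine (dist_toGStar_le hxy).trans_lt ?_
  rwa [add_comm]

/-! ### Neighbours of the root -/

/-- The number of neighbours `v` of the root such that the graph re-rooted at `v` is in `D`. -/
noncomputable def nbrCount (D : Set GStar.{u}) : GStar.{u} → ℕ :=
  Quotient.lift
    (fun x : RootedGraph.{u} => {v | x.graph.Adj x.root v ∧ (x.reroot v).toGStar ∈ D}.ncard) <| by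
    rintro x y ⟨φ, h⟩
    refine Set.ncard_congr (fun v _ => φ v) ?_ (fun a b _ _ hab => φ.injective hab) ?_
    · rintro v ⟨hv, hD⟩
      refine ⟨by rw [← h]; exact φ.map_rel_iff.2 hv, ?_⟩
      rwa [← toGStar_eq_of_isomorphic (x := x.reroot v) (y := y.reroot (φ v)) ⟨φ, rfl⟩]
    · rintro w ⟨hw, hD⟩
      refine ⟨φ.symm w, ⟨?_, ?_⟩, φ.apply_symm_apply w⟩
      · rw [← φ.map_rel_iff, φ.apply_symm_apply]
        simpa [h] using hw
      · rwa [toGStar_eq_of_isomorphic (x := x.reroot (φ.symm w)) (y := y.reroot w)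
          ⟨φ, φ.apply_symm_apply w⟩]

lemma nbrCount_toGStar (D : Set GStar.{u}) (x : RootedGraph.{u}) :
    nbrCount D x.toGStar = {v | x.graph.Adj x.root v ∧ (x.reroot v).toGStar ∈ D}.ncard := rfl

/-- The degree of the root. -/
noncomputable def rootDegree : GStar.{u} → ℕ := nbrCount Set.univ

lemma IsLocalSet.nbrCount {R : ℕ} {D : Set GStar.{u}} (hD : IsLocalSet R D) :
    IsLocal (R + 1) (nbrCount D) := by
  rintro x y ⟨φ, h⟩
  have hφ := adj_root_iff_of_ballIso φ h
  have hx : ∀ {z : RootedGraph.{u}} {v : z.V}, z.graph.Adj z.root v → v ∈ z.ball (R + 1) :=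
    fun hv => mem_ball_succ_of_adj hv (by simp)
  rw [nbrCount_toGStar, nbrCount_toGStar]
  refine Set.ncard_congr (fun v hv => φ ⟨v, hx hv.1⟩) ?_ (fun a b _ _ hab => ?_) ?_
  · rintro v ⟨hv, hvD⟩
    have hv' := (hφ ⟨v, hx hv⟩).2 hv
    have := hD _ _ (ballIso_reroot φ (v := ⟨v, hx hv⟩) hv hv')
    exact ⟨hv', this.mp hvD⟩
  · simpa using φ.injective (Subtype.ext hab)
  · rintro w ⟨hw, hwD⟩
    have hv : x.graph.Adj x.root (φ.symm ⟨w, hx hw⟩) := by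
      rw [← hφ]; simpa using hw
    refine ⟨φ.symm ⟨w, hx hw⟩, ⟨hv, ?_⟩, by simp⟩
    have hv' := (hφ _).2 hv
    have := hD _ _ (ballIso_reroot φ hv hv')
    refine this.mpr ?_
    simpa using hwD

lemma finite_nbrs (x : RootedGraph.{u}) (p : x.V → Prop) :
    {v | x.graph.Adj x.root v ∧ p v}.Finite :=
  (x.locallyFinite x.root).subset fun _ hv => hv.1

lemma nbrCount_mono {D E : Set GStar.{u}} (h : D ⊆ E) (z : GStar.{u}) :
    nbrCount D z ≤ nbrCount E z := by
  obtain ⟨x, rfl⟩ := toGStar_surjective z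
  exact Set.ncard_le_ncard (fun v hv => ⟨hv.1, h hv.2⟩) (finite_nbrs x _)

lemma nbrCount_le_rootDegree (D : Set GStar.{u}) (z : GStar.{u}) :
    nbrCount D z ≤ rootDegree z := nbrCount_mono (Set.subset_univ D) z

lemma nbrCount_union_le (D E : Set GStar.{u}) (z : GStar.{u}) :
    nbrCount (D ∪ E) z ≤ nbrCount D z + nbrCount E z := by
  obtain ⟨x, rfl⟩ := toGStar_surjective z
  refine (Set.ncard_le_ncard (fun v hv => ?_) ((finite_nbrs x _).union (finite_nbrs x _))).trans
    (Set.ncard_union_le _ _)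
  exact hv.2.imp (fun h => ⟨hv.1, h⟩) (fun h => ⟨hv.1, h⟩)

/-- Membership in `A` does not change when the root is moved to a neighbour. -/
def IsRerootInvariant (A : Set GStar.{u}) : Prop :=
  ∀ (x : RootedGraph.{u}) (v : x.V), x.graph.Adj x.root v →
    x.toGStar ∈ A → (x.reroot v).toGStar ∈ A

lemma nbrCount_eq_inter {A : Set GStar.{u}} (hA : IsRerootInvariant A) (D : Set GStar.{u})
    {z : GStar.{u}} (hz : z ∈ A) : nbrCount D z = nbrCount (D ∩ A) z := by
  obtain ⟨x, rfl⟩ := toGStar_surjective z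
  rw [nbrCount_toGStar, nbrCount_toGStar]
  congr 1
  ext v
  exact ⟨fun h => ⟨h.1, h.2, hA x v h.1 hz⟩, fun h => ⟨h.1, h.2.1⟩⟩

lemma isLocal_rootDegree : IsLocal 1 rootDegree.{u} := isLocalSet_univ.nbrCount

/-- The count for an increasing union of sets is attained at one of the sets, since the root has
finitely many neighbours. -/
lemma exists_nbrCount_iUnion {D : ℕ → Set GStar.{u}} (hD : Monotone D) (z : GStar.{u}) :
    ∃ k, nbrCount (⋃ k, D k) z = nbrCount (D k) z := by
  obtain ⟨x, rfl⟩ := toGStar_surjective z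
  have hfin := finite_nbrs x (fun v => (x.reroot v).toGStar ∈ ⋃ k, D k)
  have : ∃ k, ∀ v ∈ {v | x.graph.Adj x.root v ∧ (x.reroot v).toGStar ∈ ⋃ k, D k},
      (x.reroot v).toGStar ∈ D k := by
    have h : ∀ v ∈ {v | x.graph.Adj x.root v ∧ (x.reroot v).toGStar ∈ ⋃ k, D k},
        ∀ᶠ k in atTop, (x.reroot v).toGStar ∈ D k := by
      intro v hv
      obtain ⟨k, hk⟩ := Set.mem_iUnion.1 hv.2
      exact eventually_atTop.2 ⟨k, fun l hl => hD hl hk⟩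
    exact ((eventually_all_finite hfin).2 h).exists
  obtain ⟨k, hk⟩ := this
  refine ⟨k, le_antisymm ?_ (nbrCount_mono (Set.subset_iUnion D k) _)⟩
  exact Set.ncard_le_ncard (fun v hv => ⟨hv.1, hk v hv⟩) (finite_nbrs x _)

end GStar

/-! ### Bernoulli percolation -/

lemma measurable_set_preimage {ι κ : Type*} (e : ι → κ) :
    Measurable (fun ω : Set κ => e ⁻¹' ω) := by
  have h1 : Measurable (fun f : ι → Prop => {i | f i}) := MeasurableEquiv.setOfPred.measurable
  have h2 : (fun ω : Set κ => e ⁻¹' ω) = (fun f : ι → Prop => {i | f i}) ∘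
      (fun (f : κ → Prop) (i : ι) => f (e i)) ∘ (fun (ω : Set κ) k => k ∈ ω) := rfl
  rw [h2]
  exact h1.comp ((measurable_pi_lambda _ fun i => measurable_pi_apply _).comp
    MeasurableEquiv.setOfPred.symm.measurable)

/-- Restricting a product measure to the coordinates in the image of an injection. -/
lemma infinitePi_map_comp_injective {ι κ : Type*} {X : Type*} [MeasurableSpace X]
    (μ : κ → Measure X) [∀ k, IsProbabilityMeasure (μ k)] {e : ι → κ} (he : e.Injective) :
    (Measure.infinitePi μ).map (fun f i => f (e i)) = Measure.infinitePi (fun i => μ (e i)) := by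
  classical
  refine Measure.eq_infinitePi _ fun s t ht => ?_
  rw [Measure.map_apply (by fun_prop) (.pi s.countable_toSet fun i _ => ht i)]
  have h : (fun (f : κ → X) i => f (e i)) ⁻¹' (Set.pi s t) =
      Set.pi (s.map ⟨e, he⟩ : Finset κ) (Function.extend e t fun _ => Set.univ) := by
    ext f
    simp [Set.mem_pi, he.extend_apply]
  rw [h, Measure.infinitePi_pi]
  · simp [Finset.prod_map, he.extend_apply]
  · intro k hk
    obtain ⟨i, -, rfl⟩ := Finset.mem_map.1 hk
    simpa [he.extend_apply] using ht i

lemma setBernoulli_map_preimage {ι κ : Type*} {e : ι → κ} (he : e.Injective) (t : Set κ) (p : I) :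
    (setBer(t, p)).map (fun ω => e ⁻¹' ω) = setBer(e ⁻¹' t, p) := by
  have h1 : Measurable (fun f : ι → Prop => {i | f i}) := MeasurableEquiv.setOfPred.measurable
  have h2 : Measurable (fun f : κ → Prop => {i | f i}) := MeasurableEquiv.setOfPred.measurable
  rw [setBernoulli_eq_map, setBernoulli_eq_map, Measure.map_map (measurable_set_preimage e) h2]
  have h3 := infinitePi_map_comp_injective (fun k => unitInterval.toNNReal p •
    Measure.dirac (k ∈ t) + unitInterval.toNNReal (σ p) • Measure.dirac False) he
  simp only [Set.mem_preimage]
  rw [← h3, Measure.map_map h1 (by fun_prop)]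
  rfl

/-- Independent uniform labels realize Bernoulli percolation at all parameters simultaneously. -/
lemma setBernoulli_eq_map_uniform {ι : Type*} (s : Set ι) (p : I) :
    setBer(s, p) = (Measure.infinitePi fun _ : ι => (volume : Measure I)).map
      (fun U => {i | i ∈ s ∧ U i ≤ p}) := by
  have h1 : Measurable (fun f : ι → Prop => {i | f i}) := MeasurableEquiv.setOfPred.measurable
  have hm : ∀ i, Measurable fun t : I => i ∈ s ∧ t ≤ p := fun i =>
    measurable_const.and (measurableSet_Iic (a := p)).mem
  have hi : ∀ i, (volume : Measure I).map (fun t => i ∈ s ∧ t ≤ p) =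
      unitInterval.toNNReal p • Measure.dirac (i ∈ s) +
        unitInterval.toNNReal (σ p) • Measure.dirac False := by
    intro i
    have hp : volume (Set.Iic p) = (unitInterval.toNNReal p : ℝ≥0∞) := by
      rw [unitInterval.volume_Iic, ENNReal.ofReal_eq_coe_nnreal p.2.1]; rfl
    have hp' : volume (Set.Ioi p) = (unitInterval.toNNReal (σ p) : ℝ≥0∞) := by
      rw [unitInterval.volume_Ioi]; exact ENNReal.ofReal_eq_coe_nnreal (σ p).2.1
    have hs : (unitInterval.toNNReal p : ℝ≥0∞) + unitInterval.toNNReal (σ p) = 1 := by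
      rw [← ENNReal.coe_add]; simp
    refine Measure.ext_of_singleton fun a => ?_
    rw [Measure.map_apply (hm i) (measurableSet_singleton a)]
    have hT : i ∈ s → (fun t : I => i ∈ s ∧ t ≤ p) ⁻¹' {True} = Set.Iic p := fun hi => by
      ext t; simp [hi]
    have hF : i ∈ s → (fun t : I => i ∈ s ∧ t ≤ p) ⁻¹' {False} = Set.Ioi p := fun hi => by
      ext t; simp [hi]
    have hT' : i ∉ s → (fun t : I => i ∈ s ∧ t ≤ p) ⁻¹' {True} = ∅ := fun hi => by
      ext t; simp [hi]
    have hF' : i ∉ s → (fun t : I => i ∈ s ∧ t ≤ p) ⁻¹' {False} = Set.univ := fun hi => by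
      ext t; simp [hi]
    rw [Measure.add_apply, Measure.smul_apply, Measure.smul_apply, ENNReal.smul_def,
      ENNReal.smul_def, smul_eq_mul, smul_eq_mul, Measure.dirac_apply, Measure.dirac_apply]
    by_cases hi : i ∈ s <;> obtain rfl | rfl := Classical.propComplete a
    · rw [hT hi, hp]
      simp only [hi, Set.indicator]
      simp
    · rw [hF hi, hp']
      simp only [hi, Set.indicator]
      simp
    · rw [hT' hi]
      simp only [hi, Set.indicator]
      simp
    · rw [hF' hi]
      simp only [hi, Set.indicator]
      simp [hs]
  rw [setBernoulli_eq_map]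
  simp_rw [← hi]
  rw [← Measure.infinitePi_map_pi _ hm, Measure.map_map h1 (by fun_prop)]
  rfl

/-! ### Percolation and local events -/

namespace RootedGraph

/-- The configurations with an open self-avoiding path of `n` edges that starts in the `S`-ball.
The path visits `f 0, …, f n`; the other values of `f` play no role. -/
def pathEvent (x : RootedGraph.{u}) (S n : ℕ) : Set (Set (Sym2 x.V)) :=
  {ω | ∃ f : ℕ → x.V, Set.InjOn f (Set.Iic n) ∧ f 0 ∈ x.ball S ∧
    ∀ i < n, x.graph.Adj (f i) (f (i + 1)) ∧ s(f i, f (i + 1)) ∈ ω}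

/-- The event `pathEvent`, seen in the `(S + n)`-ball, which contains all paths concerned. -/
def ballPathEvent (x : RootedGraph.{u}) (S n : ℕ) : Set (Set (Sym2 (x.ball (S + n)))) :=
  {ω | ∃ f : ℕ → x.ball (S + n), Set.InjOn f (Set.Iic n) ∧ (f 0 : x.V) ∈ x.ball S ∧
    ∀ i < n, x.graph.Adj (f i) (f (i + 1)) ∧ s(f i, f (i + 1)) ∈ ω}

lemma pathEvent_eq_preimage {S n : ℕ} {x y : RootedGraph.{u}}
    (φ : x.graph.induce (x.ball (S + n)) ≃g y.graph.induce (y.ball (S + n)))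
    (h : φ ⟨x.root, x.root_mem_ball _⟩ = ⟨y.root, y.root_mem_ball _⟩) :
    y.pathEvent S n = (fun ω => Sym2.map (fun v => (φ v : y.V)) ⁻¹' ω) ⁻¹' x.ballPathEvent S n := by
  have h' : φ.symm ⟨y.root, y.root_mem_ball _⟩ = ⟨x.root, x.root_mem_ball _⟩ := by
    rw [← h]; simp
  ext ω
  constructor
  · rintro ⟨f, hf, h0, hadj⟩
    have hball : ∀ i ≤ n, f i ∈ y.ball (S + i) := by
      intro i
      induction i with
      | zero => exact fun _ => h0
      | succ i ih =>
        intro hi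
        have h1 := ih (by omega)
        have h2 : y.graph.dist (f i) (f (i + 1)) = 1 :=
          SimpleGraph.dist_eq_one_iff_adj.2 (hadj i (by omega)).1
        have h3 := y.connected.dist_triangle (u := y.root) (v := f i) (w := f (i + 1))
        simp only [ball, Set.mem_ofPred_eq] at h1 ⊢
        omega
    -- The values of `f` beyond `n` may lie outside the ball, and are replaced by `f n`.
    have hball' : ∀ i, f (min i n) ∈ y.ball (S + n) := fun i =>
      (hball _ (min_le_right i n)).trans (Nat.add_le_add_left (min_le_right i n) S)
    refine ⟨fun i => φ.symm ⟨f (min i n), hball' i⟩, ?_, ?_, ?_⟩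
    · intro i hi j hj hij
      have hi : min i n = i := min_eq_left hi
      have hj : min j n = j := min_eq_left hj
      have := congrArg Subtype.val (φ.symm.injective hij)
      simp only [hi, hj] at this
      exact hf (min_eq_left_iff.1 hi) (min_eq_left_iff.1 hj) this
    · exact (dist_le_of_ballIso φ.symm h' _).trans (by simpa [ball] using h0)
    · intro i hi
      have h1 : min i n = i := min_eq_left hi.le
      have h2 : min (i + 1) n = i + 1 := min_eq_left hi
      have h3 := hadj i hi
      refine ⟨?_, by simpa [h1, h2] using h3.2⟩
      have h4 : (y.graph.induce (y.ball (S + n))).Adj ⟨f (min i n), hball' i⟩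
          ⟨f (min (i + 1) n), hball' (i + 1)⟩ := by
        simpa [h1, h2] using h3.1
      exact φ.symm.map_rel_iff.2 h4
  · rintro ⟨f, hf, h0, hadj⟩
    refine ⟨fun i => φ (f i), fun i hi j hj hij => hf hi hj (φ.injective (Subtype.ext hij)),
      (dist_le_of_ballIso φ h _).trans h0, fun i hi => ⟨?_, ?_⟩⟩
    · exact φ.map_rel_iff.2 (hadj i hi).1
    · simpa using (hadj i hi).2

lemma measurableSet_pathEvent (x : RootedGraph.{u}) (S n : ℕ) :
    MeasurableSet (x.pathEvent S n) := by
  have := (x.finite_ball (S + n)).to_subtype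
  rw [pathEvent_eq_preimage (x := x) SimpleGraph.Iso.refl rfl]
  exact measurable_set_preimage _ .of_discrete

/-- The probability of `pathEvent` is that of `ballPathEvent` under percolation in the ball, in
any graph that has the same ball. -/
lemma setBernoulli_pathEvent {S n : ℕ} {x y : RootedGraph.{u}} (p : I)
    (φ : x.graph.induce (x.ball (S + n)) ≃g y.graph.induce (y.ball (S + n)))
    (h : φ ⟨x.root, x.root_mem_ball _⟩ = ⟨y.root, y.root_mem_ball _⟩) :
    setBer(y.graph.edgeSet, p) (y.pathEvent S n) =
      setBer((x.graph.induce (x.ball (S + n))).edgeSet, p) (x.ballPathEvent S n) := by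
  have := (x.finite_ball (S + n)).to_subtype
  have hinj : Function.Injective (Sym2.map (fun v => (φ v : y.V))) :=
    Sym2.map.injective (Subtype.val_injective.comp φ.injective)
  have hpre : Sym2.map (fun v => (φ v : y.V)) ⁻¹' y.graph.edgeSet =
      (x.graph.induce (x.ball (S + n))).edgeSet := by
    ext e
    induction e using Sym2.ind with
    | _ a b => exact φ.map_rel_iff
  rw [pathEvent_eq_preimage φ h, ← Measure.map_apply (measurable_set_preimage _) .of_discrete,
    setBernoulli_map_preimage hinj, hpre]

lemma BallIso.setBernoulli_pathEvent {S n : ℕ} {x y : RootedGraph.{u}}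
    (h : BallIso (S + n) x y) (p : I) :
    setBer(x.graph.edgeSet, p) (x.pathEvent S n) =
      setBer(y.graph.edgeSet, p) (y.pathEvent S n) := by
  obtain ⟨φ, h⟩ := h
  rw [RootedGraph.setBernoulli_pathEvent p φ h,
    RootedGraph.setBernoulli_pathEvent (x := x) p SimpleGraph.Iso.refl rfl]

lemma antitone_pathEvent (x : RootedGraph.{u}) (S : ℕ) : Antitone (x.pathEvent S) := by
  rintro m n hmn ω ⟨f, hf, h0, hadj⟩
  exact ⟨f, hf.mono (Set.Iic_subset_Iic.2 hmn), h0, fun i hi => hadj i (hi.trans_le hmn)⟩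

/-- In a graph without infinite components, the lengths of the paths from a ball are bounded. -/
lemma notMem_iInter_pathEvent {x : RootedGraph.{u}} {ω : Set (Sym2 x.V)}
    (hω : (SimpleGraph.fromEdgeSet ω).NoInfiniteComponent) (S : ℕ) :
    ω ∉ ⋂ n, x.pathEvent S n := by
  intro hmem
  set H := SimpleGraph.fromEdgeSet ω
  have hfin : (⋃ v ∈ x.ball S, (H.connectedComponentMk v).supp).Finite :=
    (x.finite_ball S).biUnion fun v _ => hω _
  set N := (⋃ v ∈ x.ball S, (H.connectedComponentMk v).supp).ncard
  obtain ⟨f, hf, h0, hadj⟩ := Set.mem_iInter.1 hmem N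
  have hreach : ∀ i ≤ N, H.Reachable (f i) (f 0) := by
    intro i
    induction i with
    | zero => exact fun _ => .rfl
    | succ i ih =>
      intro hi
      have h1 := hadj i (by omega)
      have h2 : H.Adj (f (i + 1)) (f i) :=
        ((SimpleGraph.fromEdgeSet_adj ω).2 ⟨h1.2, h1.1.ne⟩).symm
      exact h2.reachable.trans (ih (by omega))
  have hsub : f '' Set.Iic N ⊆ ⋃ v ∈ x.ball S, (H.connectedComponentMk v).supp := by
    rintro _ ⟨i, hi, rfl⟩
    refine Set.mem_biUnion h0 ?_
    rw [SimpleGraph.ConnectedComponent.mem_supp_iff, SimpleGraph.ConnectedComponent.eq]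
    exact hreach i hi
  have := Set.ncard_le_ncard hsub hfin
  rw [hf.ncard_image, Set.ncard_eq_toFinset_card'] at this
  simp at this
  omega

lemma noInfiniteComponent_of_forall_notMem {x : RootedGraph.{u}} {ω : Set (Sym2 x.V)}
    (hω : ω ⊆ x.graph.edgeSet) (h : ∀ S, ω ∉ ⋂ n, x.pathEvent S n) :
    (SimpleGraph.fromEdgeSet ω).NoInfiniteComponent := by
  intro C
  induction C using SimpleGraph.ConnectedComponent.ind with
  | h v =>
    obtain ⟨n, hn⟩ := not_forall.1 (mt Set.mem_iInter.2 (h (x.graph.dist x.root v)))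
    refine (x.finite_ball (x.graph.dist x.root v + n)).subset fun w hw => ?_
    rw [SimpleGraph.ConnectedComponent.mem_supp_iff, SimpleGraph.ConnectedComponent.eq] at hw
    obtain ⟨q, hq⟩ := hw.symm.exists_isPath
    have hadj : ∀ {a b}, (SimpleGraph.fromEdgeSet ω).Adj a b → x.graph.Adj a b :=
      fun hab => hω ((SimpleGraph.fromEdgeSet_adj ω).1 hab).1
    have hlen : q.length < n := by
      by_contra! hlen
      refine hn ⟨q.getVert, hq.getVert_injOn.mono fun i hi => ?_, ?_, fun i hi => ?_⟩
      · exact le_trans hi hlen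
      · simp [ball]
      · have := q.adj_getVert_succ (hi.trans_le hlen)
        exact ⟨hadj this, ((SimpleGraph.fromEdgeSet_adj ω).1 this).1⟩
    have hle : SimpleGraph.fromEdgeSet ω ≤ x.graph := fun _ _ => hadj
    have h1 := SimpleGraph.dist_le (q.mapLe hle)
    have h2 := x.connected.dist_triangle (u := x.root) (v := v) (w := w)
    simp only [SimpleGraph.Walk.mapLe, SimpleGraph.Walk.length_map] at h1
    simp only [ball, Set.mem_ofPred_eq]
    omega

/-- Percolation has no infinite component if and only if long open paths from every ball become
improbable, a condition on probabilities of local events. -/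
lemma ae_noInfiniteComponent_iff (x : RootedGraph.{u}) (p : I) :
    (∀ᵐ ω ∂setBer(x.graph.edgeSet, p), (SimpleGraph.fromEdgeSet ω).NoInfiniteComponent) ↔
      ∀ S k : ℕ, ∃ n, setBer(x.graph.edgeSet, p) (x.pathEvent S n) < (k : ℝ≥0∞)⁻¹ := by
  have := x.countable_V
  constructor
  · intro h S k
    have h0 : setBer(x.graph.edgeSet, p) (⋂ n, x.pathEvent S n) = 0 :=
      measure_mono_null (fun ω hω hω' => notMem_iInter_pathEvent hω' S hω) h
    have ht := tendsto_measure_iInter_atTop (μ := setBer(x.graph.edgeSet, p))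
      (fun n => (x.measurableSet_pathEvent S n).nullMeasurableSet) (x.antitone_pathEvent S)
      ⟨0, measure_ne_top _ _⟩
    rw [h0] at ht
    exact (ht.eventually_lt_const (by simp)).exists
  · intro h
    have h0 : ∀ S, ∀ᵐ ω ∂setBer(x.graph.edgeSet, p), ω ∉ ⋂ n, x.pathEvent S n := by
      intro S
      refine compl_mem_ae_iff.2 (not_ne_iff.1 fun hne => ?_)
      obtain ⟨k, hk⟩ := ENNReal.exists_inv_nat_lt hne
      obtain ⟨n, hn⟩ := h S k
      exact (hk.trans_le (measure_mono (Set.iInter_subset _ n))).not_gt hn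
    have : Countable (Sym2 x.V) := Quot.mk_surjective.countable
    filter_upwards [ae_all_iff.2 h0, setBernoulli_ae_subset] with ω h1 h2
    exact noInfiniteComponent_of_forall_notMem h2 h1

end RootedGraph

/-! ### Measurability of the critical probability -/

/-- The rooted graphs on which percolation at `p` has almost surely no infinite component. -/
def GStar.subcritical (p : I) : Set GStar.{u} :=
  {z | ∃ x : RootedGraph.{u}, x.toGStar = z ∧ ∀ᵐ ω ∂setBer(x.graph.edgeSet, p),
    (SimpleGraph.fromEdgeSet ω).NoInfiniteComponent}

namespace GStar

open RootedGraph

/-- The probability of `pathEvent` under percolation at `p`, as a function on `GStar`. -/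
noncomputable def pathProb (p : I) (S n : ℕ) : GStar.{u} → ℝ≥0∞ :=
  Quotient.lift (fun x : RootedGraph.{u} => setBer(x.graph.edgeSet, p) (x.pathEvent S n))
    fun _ _ h => (Isomorphic.ballIso h _).setBernoulli_pathEvent p

lemma isLocal_pathProb (p : I) (S n : ℕ) : IsLocal (S + n) (pathProb.{u} p S n) :=
  fun _ _ h => h.setBernoulli_pathEvent p

lemma subcritical_eq (p : I) :
    subcritical.{u} p = ⋂ (S : ℕ) (k : ℕ), ⋃ n, {z | pathProb p S n z < (k : ℝ≥0∞)⁻¹} := by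
  ext z
  simp only [Set.mem_iInter, Set.mem_iUnion]
  constructor
  · rintro ⟨x, rfl, h⟩
    exact x.ae_noInfiniteComponent_iff p |>.1 h
  · intro h
    obtain ⟨x, rfl⟩ := toGStar_surjective z
    exact ⟨x, rfl, x.ae_noInfiniteComponent_iff p |>.2 h⟩

lemma toGStar_mem_subcritical {p : I} {x : RootedGraph.{u}} :
    x.toGStar ∈ subcritical p ↔ ∀ᵐ ω ∂setBer(x.graph.edgeSet, p),
      (SimpleGraph.fromEdgeSet ω).NoInfiniteComponent := by
  rw [ae_noInfiniteComponent_iff, subcritical_eq]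
  simp only [Set.mem_iInter, Set.mem_iUnion]
  rfl

lemma measurableSet_subcritical (p : I) : MeasurableSet (subcritical.{u} p) := by
  rw [subcritical_eq]
  refine .iInter fun S => .iInter fun k => .iUnion fun n => ?_
  exact (isLocal_pathProb p S n).isLocallyConstant (Set.Iio (k : ℝ≥0∞)⁻¹) |>.measurableSet

/-- The labels that realize percolation at `p` and at `q` simultaneously give more open edges at the
larger parameter. -/
lemma pathProb_mono {p q : I} (hpq : p ≤ q) (S n : ℕ) (z : GStar.{u}) :
    pathProb p S n z ≤ pathProb q S n z := by
  obtain ⟨x, rfl⟩ := toGStar_surjective z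
  change setBer(x.graph.edgeSet, p) (x.pathEvent S n) ≤
    setBer(x.graph.edgeSet, q) (x.pathEvent S n)
  have hm : ∀ r : I, Measurable fun U : Sym2 x.V → I => {e | e ∈ x.graph.edgeSet ∧ U e ≤ r} :=
    fun r => MeasurableEquiv.setOfPred.measurable.comp (measurable_pi_lambda _ fun e =>
      measurable_const.and ((measurableSet_Iic (a := r)).mem.comp (measurable_pi_apply e)))
  rw [setBernoulli_eq_map_uniform, setBernoulli_eq_map_uniform,
    Measure.map_apply (hm p) (x.measurableSet_pathEvent S n),
    Measure.map_apply (hm q) (x.measurableSet_pathEvent S n)]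
  refine measure_mono ?_
  rintro U ⟨f, hf, h0, hadj⟩
  exact ⟨f, hf, h0, fun i hi => ⟨(hadj i hi).1, (hadj i hi).2.1, (hadj i hi).2.2.trans hpq⟩⟩

lemma subcritical_anti {p q : I} (hpq : p ≤ q) : subcritical.{u} q ⊆ subcritical p := by
  rw [subcritical_eq, subcritical_eq]
  refine Set.iInter_mono fun S => Set.iInter_mono fun k => Set.iUnion_mono fun n z hz => ?_
  exact (pathProb_mono hpq S n z).trans_lt hz

lemma lt_criticalProbability_iff {q : ℝ} (hq : 0 ≤ q) (z : GStar.{u}) :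
    q < z.criticalProbability ↔ ∃ r : ℚ, ∃ h : (r : ℝ) ∈ I, q < r ∧ z ∈ subcritical ⟨r, h⟩ := by
  obtain ⟨x, rfl⟩ := toGStar_surjective z
  have hbdd : BddAbove ((fun p : I => (p : ℝ)) '' {p : I | ∀ᵐ ω ∂setBer(x.graph.edgeSet, p),
      (SimpleGraph.fromEdgeSet ω).NoInfiniteComponent}) :=
    ⟨1, by rintro _ ⟨p, -, rfl⟩; exact p.2.2⟩
  constructor
  · intro h
    have hne : ((fun p : I => (p : ℝ)) '' {p : I | ∀ᵐ ω ∂setBer(x.graph.edgeSet, p),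
        (SimpleGraph.fromEdgeSet ω).NoInfiniteComponent}).Nonempty := by
      by_contra hemp
      rw [Set.not_nonempty_iff_eq_empty] at hemp
      have : x.toGStar.criticalProbability = 0 := by
        change sSup _ = _
        rw [hemp, Real.sSup_empty]
      linarith
    obtain ⟨_, ⟨p, hp, rfl⟩, hqp⟩ := exists_lt_of_lt_csSup hne h
    obtain ⟨r, hr1, hr2⟩ := exists_rat_btwn hqp
    refine ⟨r, ⟨hq.trans hr1.le, hr2.le.trans p.2.2⟩, hr1, ?_⟩
    exact subcritical_anti (q := p) hr2.le (toGStar_mem_subcritical.2 hp)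
  · rintro ⟨r, h, hqr, hr⟩
    exact hqr.trans_le (le_csSup hbdd ⟨⟨r, h⟩, toGStar_mem_subcritical.1 hr, rfl⟩)

lemma criticalProbability_nonneg (z : GStar.{u}) : 0 ≤ z.criticalProbability := by
  obtain ⟨x, rfl⟩ := toGStar_surjective z
  exact Real.sSup_nonneg (by rintro _ ⟨p, -, rfl⟩; exact p.2.1)

lemma measurable_criticalProbability : Measurable GStar.criticalProbability.{u} := by
  refine measurable_of_Ioi fun q => ?_
  rcases lt_or_ge q 0 with hq | hq
  · convert MeasurableSet.univ
    exact Set.eq_univ_of_forall fun z => hq.trans_le z.criticalProbability_nonneg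
  · have : GStar.criticalProbability.{u} ⁻¹' Set.Ioi q =
        ⋃ (r : ℚ) (h : (r : ℝ) ∈ I) (_ : q < r), subcritical ⟨r, h⟩ := by
      ext z
      simpa using lt_criticalProbability_iff hq z
    rw [this]
    exact .iUnion fun r => .iUnion fun h => .iUnion fun _ => measurableSet_subcritical _

end GStar

/-! ### Uniformly rooted finite graphs -/

open GStar RootedGraph

namespace SimpleGraph

lemma toGStar_component {V : Type u} [Finite V] (G : SimpleGraph V) (C : G.ConnectedComponent)
    (v : C) (h1 : C.toSimpleGraph.Connected) (h2 : ∀ v, (C.toSimpleGraph.neighborSet v).Finite) :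
    (⟨C, C.toSimpleGraph, v, h1, h2⟩ : RootedGraph).toGStar = G.rootedAt v := by
  obtain ⟨v, rfl⟩ := v
  rfl

variable {V : Type u} [Fintype V]

open Classical in
lemma nbrCount_rootedAt (G : SimpleGraph V) (D : Set GStar.{u}) (v : V) :
    nbrCount D (G.rootedAt v) =
      (Finset.univ.filter fun w => G.Adj v w ∧ G.rootedAt w ∈ D).card := by
  rw [← Set.ncard_coe_finset]
  refine Set.ncard_congr (fun w _ => w.1) ?_ (fun a b _ _ h => Subtype.ext h) ?_
  · rintro w ⟨hw, hD⟩
    have := toGStar_component G (G.connectedComponentMk v) w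
      (G.connectedComponentMk v).connected_toSimpleGraph (fun _ => Set.toFinite _)
    simp only [Finset.coe_filter, Finset.mem_univ, true_and, Set.mem_ofPred_eq]
    exact ⟨hw, this ▸ hD⟩
  · intro w hw
    simp only [Finset.coe_filter, Finset.mem_univ, true_and, Set.mem_ofPred_eq] at hw
    have hmem : w ∈ G.connectedComponentMk v :=
      (SimpleGraph.ConnectedComponent.eq.2 hw.1.reachable).symm
    have := toGStar_component G (G.connectedComponentMk v) ⟨w, hmem⟩
      (G.connectedComponentMk v).connected_toSimpleGraph (fun _ => Set.toFinite _)
    exact ⟨⟨w, hmem⟩, ⟨hw.1, this ▸ hw.2⟩, rfl⟩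

lemma lintegral_localLaw [Nonempty V] (G : SimpleGraph V) {f : GStar.{u} → ℝ≥0∞}
    (hf : Measurable f) :
    ∫⁻ z, f z ∂(G.localLaw : Measure GStar.{u}) = (∑ v, f (G.rootedAt v)) / Fintype.card V := by
  let _ : MeasurableSpace V := ⊤
  have : (G.localLaw : Measure GStar.{u}) =
      (PMF.uniformOfFintype V).toMeasure.map G.rootedAt :=
    (PMF.toMeasure_map _ (PMF.uniformOfFintype V) measurable_from_top).symm
  have h1 : ∀ v, (PMF.uniformOfFintype V).toMeasure {v} = (Fintype.card V : ℝ≥0∞)⁻¹ := fun v => by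
    rw [PMF.toMeasure_apply_singleton _ _ (measurableSet_singleton v), PMF.uniformOfFintype_apply]
  rw [this, lintegral_map hf measurable_from_top, lintegral_fintype]
  simp_rw [h1, ← Finset.sum_mul, ENNReal.div_eq_inv_mul, mul_comm]

/-- Double counting of the pairs of adjacent vertices whose second entry is in `D`. -/
lemma sum_nbrCount_rootedAt (G : SimpleGraph V) (D : Set GStar.{u}) :
    ∑ v, nbrCount D (G.rootedAt v) = ∑ v, D.indicator rootDegree (G.rootedAt v) := by
  classical
  have h : ∀ v, D.indicator rootDegree (G.rootedAt v) =
      ∑ w, if G.Adj w v ∧ G.rootedAt v ∈ D then 1 else 0 := by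
    intro v
    by_cases hv : G.rootedAt v ∈ D
    · simp [hv, rootDegree, nbrCount_rootedAt, G.adj_comm]
    · simp [hv]
  simp_rw [h, nbrCount_rootedAt, Finset.card_filter]
  exact Finset.sum_comm

open Classical in
lemma rootDegree_rootedAt (G : SimpleGraph V) (v : V) :
    rootDegree (G.rootedAt v) = G.degree v := by
  simp [rootDegree, nbrCount_rootedAt, ← card_neighborFinset_eq_degree, neighborFinset_eq_filter]

open Classical in
lemma sum_boundary_rootedAt (G : SimpleGraph V) (B : Set GStar.{u}) :
    ∑ v, B.indicator (nbrCount Bᶜ) (G.rootedAt v) =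
      (G.interedges (Finset.univ.filter fun v => G.rootedAt v ∈ B)
        (Finset.univ.filter fun v => G.rootedAt v ∈ B)ᶜ).card := by
  have h : ∀ v, B.indicator (nbrCount Bᶜ) (G.rootedAt v) =
      ∑ w, if G.rootedAt v ∈ B ∧ G.rootedAt w ∉ B ∧ G.Adj v w then 1 else 0 := by
    intro v
    by_cases hv : G.rootedAt v ∈ B
    · simp [hv, nbrCount_rootedAt, and_comm]
    · simp [hv]
  simp_rw [h]
  rw [← Fintype.sum_prod_type' (f := fun v w =>
    if G.rootedAt v ∈ B ∧ G.rootedAt w ∉ B ∧ G.Adj v w then 1 else 0), ← Finset.card_filter]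
  congr 1
  ext ⟨v, w⟩
  simp [mem_interedges_iff]

/-- The expansion bounds the boundary of every set of density in `[δ, 1 - δ]`: the bound applies
to the set or to its complement, which have the same boundary. -/
lemma mul_card_le_card_interedges [Nonempty V] (G : SimpleGraph V) {c : ℝ≥0∞} {δ : ℝ}
    (hc : c ≤ G.expansion δ) (A : Finset V) (h1 : δ ≤ (A.card : ℝ) / Fintype.card V)
    (h2 : (A.card : ℝ) / Fintype.card V ≤ 1 - δ) :
    open Classical in
    c * ENNReal.ofReal δ * Fintype.card V ≤ ((G.interedges A Aᶜ).card : ℝ≥0∞) := by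
  classical
  have hV : (0 : ℝ) < Fintype.card V := by exact_mod_cast Fintype.card_pos
  have key : ∀ A : Finset V, δ ≤ (A.card : ℝ) / Fintype.card V →
      (A.card : ℝ) / Fintype.card V ≤ 1 / 2 →
      c * ENNReal.ofReal δ * Fintype.card V ≤ ((G.interedges A Aᶜ).card : ℝ≥0∞) := by
    intro A hA1 hA2
    have h3 : c ≤ ((G.interedges A Aᶜ).card : ℝ≥0∞) / (A.card : ℝ≥0∞) :=
      hc.trans ((iInf₂_le A ⟨hA1, hA2⟩).trans_eq (by congr))
    have h4 : ENNReal.ofReal δ * Fintype.card V ≤ A.card := by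
      rw [← ENNReal.ofReal_natCast (Fintype.card V), ← ENNReal.ofReal_natCast A.card,
        ← ENNReal.ofReal_mul' hV.le]
      exact ENNReal.ofReal_le_ofReal ((le_div_iff₀ hV).1 hA1)
    rw [mul_assoc]
    exact (mul_le_mul' le_rfl h4).trans (ENNReal.mul_le_of_le_div h3)
  by_cases hA : (A.card : ℝ) / Fintype.card V ≤ 1 / 2
  · convert key A h1 hA
  · have h5 : ((Aᶜ).card : ℝ) / Fintype.card V = 1 - (A.card : ℝ) / Fintype.card V := by
      rw [Finset.card_compl, Nat.cast_sub (Finset.card_le_univ A), sub_div, div_self hV.ne']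
    have h6 := key Aᶜ (by rw [h5]; linarith) (by rw [h5]; push Not at hA; linarith)
    have := G.symm
    have hcomm : (G.interedges Aᶜ A).card = (G.interedges A Aᶜ).card :=
      Rel.card_interedges_comm _ _
    rw [compl_compl, hcomm] at h6
    convert h6

end SimpleGraph

/-! ### Passing to the local limit -/

lemma GStar.IsLocal.measurable_natCast {R : ℕ} {f : GStar.{u} → ℕ} (hf : IsLocal R f) :
    Measurable fun z => (f z : ℝ≥0∞) :=
  (IsLocal.continuous (hf.comp fun k : ℕ => (k : ℝ≥0∞))).measurable

namespace LocallyWeaklyConverges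

variable {V : ℕ → Type u} [∀ n, Fintype (V n)] [∀ n, Nonempty (V n)]
  {G : ∀ n, SimpleGraph (V n)} {μ : ProbabilityMeasure GStar.{u}}

/-- Fatou's lemma for local weak convergence; `f` may be unbounded. -/
lemma lintegral_le_liminf (hlim : LocallyWeaklyConverges G μ) {R : ℕ} {f : GStar.{u} → ℕ}
    (hf : IsLocal R f) :
    ∫⁻ z, f z ∂(μ : Measure GStar.{u}) ≤
      liminf (fun n => ((∑ v, f ((G n).rootedAt v) : ℕ) : ℝ≥0∞) / Fintype.card (V n)) atTop := by
  have h := lintegral_le_liminf_lintegral_of_forall_isOpen_measure_le_liminf_measure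
    (μ := (μ : Measure GStar.{u})) (μs := fun n => ((G n).localLaw : Measure GStar.{u}))
    (IsLocal.continuous (hf.comp fun k : ℕ => (k : ℝ))) (fun z => Nat.cast_nonneg _)
    fun U hU => ProbabilityMeasure.le_liminf_measure_open_of_tendsto hlim hU
  simp only [ENNReal.ofReal_natCast] at h
  refine h.trans_eq ?_
  simp only [SimpleGraph.lintegral_localLaw _ hf.measurable_natCast, Nat.cast_sum]

lemma tendsto_average (hlim : LocallyWeaklyConverges G μ) {R K : ℕ} {f : GStar.{u} → ℕ}
    (hf : IsLocal R f) (hK : ∀ z, f z ≤ K) :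
    Tendsto (fun n => ((∑ v, f ((G n).rootedAt v) : ℕ) : ℝ≥0∞) / Fintype.card (V n)) atTop
      (𝓝 (∫⁻ z, f z ∂(μ : Measure GStar.{u}))) := by
  let F : BoundedContinuousFunction GStar.{u} NNReal := .mkOfBound
    ⟨fun z => (f z : NNReal), IsLocal.continuous (hf.comp fun k : ℕ => (k : NNReal))⟩ K <| by
      intro x y
      have hx : (f x : ℝ) ≤ K := by exact_mod_cast hK x
      have hy : (f y : ℝ) ≤ K := by exact_mod_cast hK y
      have hx' : (0 : ℝ) ≤ f x := Nat.cast_nonneg _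
      have hy' : (0 : ℝ) ≤ f y := Nat.cast_nonneg _
      simp only [ContinuousMap.coe_mk, NNReal.dist_eq, NNReal.coe_natCast]
      rw [abs_le]
      constructor <;> linarith
  have h := ProbabilityMeasure.tendsto_iff_forall_lintegral_tendsto.1 hlim F
  have hF : ∀ z, (F z : ℝ≥0∞) = f z := fun z => ENNReal.coe_natCast _
  simp only [hF, SimpleGraph.lintegral_localLaw _ hf.measurable_natCast] at h
  simpa only [Nat.cast_sum] using h

/-- The root of the limit has finite expected degree. -/
lemma lintegral_rootDegree_le (hlim : LocallyWeaklyConverges G μ) {d : ℝ}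
    (hdeg : ∀ n, (G n).averageDegree ≤ d) :
    ∫⁻ z, rootDegree z ∂(μ : Measure GStar.{u}) ≤ ENNReal.ofReal d := by
  classical
  refine (hlim.lintegral_le_liminf isLocal_rootDegree).trans ?_
  have h : ∀ n, ((∑ v, rootDegree ((G n).rootedAt v) : ℕ) : ℝ≥0∞) / Fintype.card (V n) ≤
      ENNReal.ofReal d := by
    intro n
    have hV : (0 : ℝ) < Fintype.card (V n) := by exact_mod_cast Fintype.card_pos
    rw [← ENNReal.ofReal_natCast, ← ENNReal.ofReal_natCast (Fintype.card (V n)),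
      ← ENNReal.ofReal_div_of_pos hV]
    refine ENNReal.ofReal_le_ofReal (le_trans (le_of_eq ?_) (hdeg n))
    simp only [SimpleGraph.averageDegree, SimpleGraph.rootDegree_rootedAt, Nat.cast_sum]
  exact (liminf_le_liminf (.of_forall h)).trans_eq (liminf_const _)

/-- The bound on the degree makes the right-hand side converge along the sequence, while Fatou's
lemma is enough for the left-hand side. -/
lemma lintegral_nbrCount_le_of_isLocalSet (hlim : LocallyWeaklyConverges G μ) {R K : ℕ}
    {D : Set GStar.{u}} (hD : IsLocalSet R D) (hK : ∀ z ∈ D, rootDegree z ≤ K) :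
    ∫⁻ z, nbrCount D z ∂(μ : Measure GStar.{u}) ≤
      ∫⁻ z in D, rootDegree z ∂(μ : Measure GStar.{u}) := by
  classical
  have hloc : IsLocal (max R 1) (D.indicator rootDegree) :=
    (hD.comp₂ isLocal_rootDegree fun (p : Prop) k => if p then k else 0)
  have h2 := hlim.tendsto_average (K := K) hloc fun z => by
    by_cases hz : z ∈ D
    · simpa [hz] using hK z hz
    · simp [hz]
  have h1 := hlim.lintegral_le_liminf hD.nbrCount
  simp only [SimpleGraph.sum_nbrCount_rootedAt] at h1
  rw [h2.liminf_eq] at h1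
  refine h1.trans_eq ?_
  rw [← lintegral_indicator hD.measurableSet]
  congr 1 with z
  by_cases hz : z ∈ D <;> simp [hz]

/-- A mass transport inequality for the limit, inherited from double counting in the finite
graphs: the expected number of neighbours in `D` of the root is at most the expected degree of the
root on `D`. -/
lemma lintegral_nbrCount_le (hlim : LocallyWeaklyConverges G μ) {D : Set GStar.{u}}
    (hD : IsOpen D) :
    ∫⁻ z, nbrCount D z ∂(μ : Measure GStar.{u}) ≤
      ∫⁻ z in D, rootDegree z ∂(μ : Measure GStar.{u}) := by
  let E : ℕ → Set GStar.{u} := fun k => localInterior D k ∩ {z | rootDegree z ≤ k}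
  have hE : Monotone E := fun k l hkl => Set.inter_subset_inter (monotone_localInterior D hkl)
    fun z hz => le_trans hz hkl
  have hEloc : ∀ k, IsLocalSet (max k 1) (E k) := fun k =>
    (isLocalSet_localInterior D k).inter (isLocal_rootDegree.comp fun j => j ≤ k)
  have hEU : ⋃ k, E k = D := by
    refine (Set.iUnion_subset fun k => Set.inter_subset_left.trans
      (localInterior_subset D k)).antisymm fun z hz => ?_
    rw [← iUnion_localInterior hD] at hz
    obtain ⟨k, hk⟩ := Set.mem_iUnion.1 hz
    exact Set.mem_iUnion.2 ⟨max k (rootDegree z),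
      monotone_localInterior D (le_max_left _ _) hk, le_max_right k _⟩
  calc ∫⁻ z, nbrCount D z ∂(μ : Measure GStar.{u})
      ≤ ∫⁻ z, ⨆ k, (nbrCount (E k) z : ℝ≥0∞) ∂(μ : Measure GStar.{u}) := by
        refine lintegral_mono fun z => ?_
        obtain ⟨k, hk⟩ := exists_nbrCount_iUnion hE z
        rw [hEU] at hk
        rw [hk]
        exact le_iSup (fun k => (nbrCount (E k) z : ℝ≥0∞)) k
    _ = ⨆ k, ∫⁻ z, nbrCount (E k) z ∂(μ : Measure GStar.{u}) :=
        lintegral_iSup (fun k => (hEloc k).nbrCount.measurable_natCast)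
          fun k l hkl z => Nat.cast_le.2 (nbrCount_mono (hE hkl) z)
    _ ≤ ∫⁻ z in D, rootDegree z ∂(μ : Measure GStar.{u}) := iSup_le fun k =>
        (hlim.lintegral_nbrCount_le_of_isLocalSet (hEloc k) (K := k) fun z hz => hz.2).trans
          (lintegral_mono_set (hEU ▸ Set.subset_iUnion E k))

/-- Expansion passes to the limit: a local event of intermediate probability on which the degree is
bounded has a large boundary. -/
lemma mul_le_lintegral_boundary (hlim : LocallyWeaklyConverges G μ) {c : ℝ≥0∞} {δ : ℝ}
    (hc : ∀ᶠ n in atTop, c ≤ (G n).expansion δ) {R K : ℕ} {B : Set GStar.{u}}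
    (hB : IsLocalSet R B) (hK : ∀ z ∈ B, rootDegree z ≤ K)
    (h1 : ENNReal.ofReal δ < (μ : Measure GStar.{u}) B)
    (h2 : (μ : Measure GStar.{u}) B < ENNReal.ofReal (1 - δ)) :
    c * ENNReal.ofReal δ ≤ ∫⁻ z in B, nbrCount Bᶜ z ∂(μ : Measure GStar.{u}) := by
  classical
  have hloc1 : IsLocal R (B.indicator (1 : GStar.{u} → ℕ)) :=
    hB.comp fun p : Prop => if p then 1 else 0
  have hdens := hlim.tendsto_average (K := 1) hloc1 fun z => by
    by_cases hz : z ∈ B <;> simp [hz]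
  have hmeas : ∫⁻ z, (B.indicator (1 : GStar.{u} → ℕ) z : ℕ) ∂(μ : Measure GStar.{u}) =
      (μ : Measure GStar.{u}) B := by
    rw [← lintegral_indicator_one hB.measurableSet]
    congr 1 with z
    by_cases hz : z ∈ B <;> simp [hz]
  rw [hmeas] at hdens
  have hloc2 : IsLocal (max R (R + 1)) (B.indicator (nbrCount Bᶜ)) :=
    hB.comp₂ hB.compl.nbrCount fun (p : Prop) k => if p then k else 0
  have hbd := hlim.tendsto_average (K := K) hloc2 fun z => by
    by_cases hz : z ∈ B
    · simpa [hz] using (nbrCount_le_rootDegree _ z).trans (hK z hz)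
    · simp [hz]
  have hint : ∫⁻ z, (B.indicator (nbrCount Bᶜ) z : ℕ) ∂(μ : Measure GStar.{u}) =
      ∫⁻ z in B, nbrCount Bᶜ z ∂(μ : Measure GStar.{u}) := by
    rw [← lintegral_indicator hB.measurableSet]
    congr 1 with z
    by_cases hz : z ∈ B <;> simp [hz]
  rw [← hint]
  refine ge_of_tendsto hbd ?_
  filter_upwards [hc, hdens.eventually_const_lt h1, hdens.eventually_lt_const h2] with n hn h3 h4
  have hV : (0 : ℝ) < Fintype.card (V n) := by exact_mod_cast Fintype.card_pos
  set A : Finset (V n) := Finset.univ.filter fun v => (G n).rootedAt v ∈ B with hA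
  have hcard : ∑ v, B.indicator (1 : GStar.{u} → ℕ) ((G n).rootedAt v) = A.card := by
    rw [hA, Finset.card_filter]
    rfl
  rw [hcard, ← ENNReal.ofReal_natCast, ← ENNReal.ofReal_natCast (Fintype.card (V n)),
    ← ENNReal.ofReal_div_of_pos hV] at h3 h4
  have h3 := (ENNReal.ofReal_lt_ofReal_iff'.1 h3).1
  have h4 := (ENNReal.ofReal_lt_ofReal_iff'.1 h4).1
  have h5 := (G n).mul_card_le_card_interedges hn A h3.le h4.le
  rw [SimpleGraph.sum_boundary_rootedAt, ENNReal.le_div_iff_mul_le (by simp) (by simp)]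
  convert h5

end LocallyWeaklyConverges

/-! ### The zero-one law -/

lemma exists_measure_lt_of_antitone {α : Type*} [MeasurableSpace α] (m : Measure α)
    [IsFiniteMeasure m] {s : ℕ → Set α} (hs : ∀ k, MeasurableSet (s k)) (hanti : Antitone s)
    (hempty : ⋂ k, s k = ∅) {ε : ℝ≥0∞} (hε : 0 < ε) : ∃ k, m (s k) < ε := by
  have h := tendsto_measure_iInter_atTop (μ := m) (fun k => (hs k).nullMeasurableSet) hanti
    ⟨0, measure_ne_top _ _⟩
  rw [hempty, measure_empty] at h
  exact (h.eventually_lt_const hε).exists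

/-- The local limit of an expanding sequence is ergodic: an event that does not depend on the
position of the root has probability zero or one. -/
theorem zero_one_of_isRerootInvariant {V : ℕ → Type u} [∀ n, Fintype (V n)] [∀ n, Nonempty (V n)]
    {G : ∀ n, SimpleGraph (V n)} {μ : ProbabilityMeasure GStar.{u}} {d : ℝ}
    (hexp : IsExpanding G) (hdeg : ∀ n, (G n).averageDegree ≤ d)
    (hlim : LocallyWeaklyConverges G μ) {A : Set GStar.{u}} (hA : MeasurableSet A)
    (hinv : IsRerootInvariant A) :
    (μ : Measure GStar.{u}) A = 0 ∨ (μ : Measure GStar.{u}) A = 1 := by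
  by_contra! hne
  obtain ⟨h0, h1⟩ := hne
  set a : ℝ := (μ : Measure GStar.{u}).real A with ha
  have haA : ENNReal.ofReal a = (μ : Measure GStar.{u}) A := ofReal_measureReal
  have ha0 : 0 < a := by
    rw [ha, measureReal_def]
    exact ENNReal.toReal_pos h0 (measure_ne_top _ _)
  have ha1 : a < 1 := lt_of_le_of_ne measureReal_le_one fun h => h1 <| by
    rw [← haA, h, ENNReal.ofReal_one]
  -- With this `δ`, every set whose measure differs from that of `A` by less than `δ` has measure in
  -- the range `(δ, 1 - δ)` to which the expansion applies.
  set δ : ℝ := min a (1 - a) / 2 with hδ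
  have hδ0 : 0 < δ := by
    have := lt_min ha0 (sub_pos.2 ha1)
    positivity
  have hδa : 2 * δ ≤ a := by rw [hδ]; linarith [min_le_left a (1 - a)]
  have hδa' : a ≤ 1 - 2 * δ := by rw [hδ]; linarith [min_le_right a (1 - a)]
  obtain ⟨c, hc0, hc⟩ := exists_between (hexp δ hδ0 (by linarith))
  have hc : ∀ᶠ n in atTop, c ≤ (G n).expansion δ :=
    (eventually_lt_of_lt_liminf hc).mono fun n hn => hn.le
  -- Three errors of size `ε`, from `U \ A`, `U \ W` and `H` below, enter both the measure of the
  -- approximating set `W ∩ Hᶜ` and the size of its boundary.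
  obtain ⟨ε, hε0, hεδ, hεc⟩ : ∃ ε : ℝ≥0∞, 0 < ε ∧ 3 * ε < ENNReal.ofReal δ ∧
      3 * ε < c * ENNReal.ofReal δ := by
    have hd : 0 < ENNReal.ofReal δ := ENNReal.ofReal_pos.2 hδ0
    have h3 : 0 < min (ENNReal.ofReal δ) (c * ENNReal.ofReal δ) :=
      lt_min hd (ENNReal.mul_pos hc0.ne' hd.ne')
    obtain ⟨η, hη0, hη⟩ := exists_between h3
    refine ⟨η / 3, ENNReal.div_pos hη0.ne' (by simp), ?_⟩
    rw [ENNReal.mul_div_cancel (by simp) (by simp)]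
    exact lt_min_iff.1 hη
  -- Approximation is carried out with respect to the measure biased by the degree of the root,
  -- so that it controls numbers of edges as well as probabilities.
  have hdm : Measurable fun z : GStar.{u} => (rootDegree z : ℝ≥0∞) :=
    isLocal_rootDegree.measurable_natCast
  set m : Measure GStar.{u} := (μ : Measure GStar.{u}) +
    (μ : Measure GStar.{u}).withDensity fun z => rootDegree z with hm
  have : IsFiniteMeasure ((μ : Measure GStar.{u}).withDensity fun z => (rootDegree z : ℝ≥0∞)) :=
    isFiniteMeasure_withDensity
      ((hlim.lintegral_rootDegree_le hdeg).trans_lt ENNReal.ofReal_lt_top).ne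
  have hμm : ∀ s, (μ : Measure GStar.{u}) s ≤ m s := fun s => by
    rw [hm, Measure.add_apply]; exact le_self_add
  have hdegm : ∀ {s}, MeasurableSet s →
      ∫⁻ z in s, rootDegree z ∂(μ : Measure GStar.{u}) ≤ m s := fun hs => by
    rw [hm, Measure.add_apply, withDensity_apply _ hs]; exact le_add_self
  obtain ⟨U, hAU, hU, -, hUA⟩ := hA.exists_isOpen_sdiff_lt (measure_ne_top m A) hε0.ne'
  obtain ⟨R, hR⟩ : ∃ R, m (U \ localInterior U R) < ε := by
    refine exists_measure_lt_of_antitone m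
      (fun R => hU.measurableSet.diff (isLocalSet_localInterior U R).measurableSet)
      (fun R S h => Set.sdiff_subset_sdiff_right (monotone_localInterior U h)) ?_ hε0
    rw [← Set.sdiff_iUnion, iUnion_localInterior hU, Set.sdiff_self]
  have hloc : ∀ k, IsLocalSet 1 {z : GStar.{u} | k < rootDegree z} := fun k =>
    isLocal_rootDegree.comp fun j => k < j
  obtain ⟨K, hK⟩ : ∃ K, m {z | K < rootDegree z} < ε := by
    refine exists_measure_lt_of_antitone m (fun k => (hloc k).measurableSet)
      (fun k l h z hz => lt_of_le_of_lt h hz) ?_ hε0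
    refine Set.eq_empty_of_forall_notMem fun z hz => ?_
    have hlt : rootDegree z < rootDegree z := Set.mem_iInter.1 hz (rootDegree z)
    exact lt_irrefl _ hlt
  set W := localInterior U R
  set H : Set GStar.{u} := {z | K < rootDegree z}
  have hWloc : IsLocalSet R W := isLocalSet_localInterior U R
  have hWU : W ⊆ U := localInterior_subset U R
  have hB : IsLocalSet (max R 1) (W ∩ Hᶜ) := hWloc.inter (hloc K).compl
  have hAB : (μ : Measure GStar.{u}) A ≤ (μ : Measure GStar.{u}) (W ∩ Hᶜ) + 3 * ε := by
    have hsub : A ⊆ (W ∩ Hᶜ) ∪ ((U \ W) ∪ H) := fun z hz => by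
      have := hAU hz
      by_cases h1 : z ∈ W <;> by_cases h2 : z ∈ H <;> simp [h1, h2, this]
    refine (measure_mono hsub).trans ((measure_union_le _ _).trans
      (add_le_add_right ((measure_union_le _ _).trans ?_) _))
    calc _ ≤ ε + ε := add_le_add ((hμm _).trans hR.le) ((hμm _).trans hK.le)
      _ ≤ 3 * ε := by rw [← two_mul]; gcongr; norm_num
  have hBA : (μ : Measure GStar.{u}) (W ∩ Hᶜ) ≤ (μ : Measure GStar.{u}) A + 3 * ε := by
    have hsub : W ∩ Hᶜ ⊆ A ∪ (U \ A) := fun z hz => by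
      by_cases h : z ∈ A <;> simp [h, hWU hz.1]
    refine (measure_mono hsub).trans ((measure_union_le _ _).trans
      (add_le_add_right (((hμm _).trans hUA.le).trans ?_) _))
    calc ε = 1 * ε := (one_mul ε).symm
      _ ≤ 3 * ε := by gcongr; norm_num
  have hlow : ENNReal.ofReal δ < (μ : Measure GStar.{u}) (W ∩ Hᶜ) := by
    by_contra! h
    have h3 : (μ : Measure GStar.{u}) A < ENNReal.ofReal δ + ENNReal.ofReal δ :=
      hAB.trans_lt (ENNReal.add_lt_add_of_le_of_lt (by finiteness) h hεδ)
    rw [← haA, ← ENNReal.ofReal_add hδ0.le hδ0.le,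
      ENNReal.ofReal_lt_ofReal_iff_of_nonneg ha0.le] at h3
    linarith
  have hhigh : (μ : Measure GStar.{u}) (W ∩ Hᶜ) < ENNReal.ofReal (1 - δ) := by
    have h3 := hBA.trans_lt (ENNReal.add_lt_add_of_le_of_lt (by finiteness) le_rfl hεδ)
    rw [← haA, ← ENNReal.ofReal_add ha0.le hδ0.le] at h3
    exact h3.trans_le (ENNReal.ofReal_le_ofReal (by linarith))
  have hlarge := hlim.mul_le_lintegral_boundary hc hB (K := K)
    (fun z hz => not_lt.1 hz.2) hlow hhigh
  -- An edge leaving `W ∩ Hᶜ` ends in `H`, or starts outside `A`, or ends in `A \ W ⊆ U \ W`.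
  have hpoint : ∀ z, (W ∩ Hᶜ).indicator (fun z => (nbrCount (W ∩ Hᶜ)ᶜ z : ℝ≥0∞)) z ≤
      (nbrCount H z + nbrCount (U \ W) z) +
        (U \ A).indicator (fun z => (rootDegree z : ℝ≥0∞)) z := by
    intro z
    by_cases hz : z ∈ W ∩ Hᶜ
    swap
    · simp [hz]
    rw [Set.indicator_of_mem hz, Set.compl_inter, compl_compl]
    have h3 := nbrCount_union_le Wᶜ H z
    by_cases hzA : z ∈ A
    · have h4 : nbrCount Wᶜ z ≤ nbrCount (U \ W) z := by
        rw [nbrCount_eq_inter hinv _ hzA]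
        have hsub : Wᶜ ∩ A ⊆ U \ W := fun w hw => ⟨hAU hw.2, hw.1⟩
        exact nbrCount_mono hsub z
      refine le_trans ?_ le_self_add
      exact_mod_cast (by omega : nbrCount (Wᶜ ∪ H) z ≤ nbrCount H z + nbrCount (U \ W) z)
    · have hzU : z ∈ U \ A := ⟨hWU hz.1, hzA⟩
      rw [Set.indicator_of_mem hzU]
      have h4 := nbrCount_le_rootDegree Wᶜ z
      exact_mod_cast (by omega : nbrCount (Wᶜ ∪ H) z ≤
        nbrCount H z + nbrCount (U \ W) z + rootDegree z)
  have hsmall : ∫⁻ z in W ∩ Hᶜ, nbrCount (W ∩ Hᶜ)ᶜ z ∂(μ : Measure GStar.{u}) ≤ 3 * ε := by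
    have hUA' : MeasurableSet (U \ A) := hU.measurableSet.diff hA
    have hUW : IsOpen (U \ W) := hU.sdiff hWloc.isClopen.isClosed
    calc ∫⁻ z in W ∩ Hᶜ, nbrCount (W ∩ Hᶜ)ᶜ z ∂(μ : Measure GStar.{u})
        ≤ ∫⁻ z, (nbrCount H z + nbrCount (U \ W) z) +
          (U \ A).indicator (fun z => (rootDegree z : ℝ≥0∞)) z ∂(μ : Measure GStar.{u}) := by
          rw [← lintegral_indicator hB.measurableSet]
          exact lintegral_mono hpoint
      _ = (∫⁻ z, nbrCount H z ∂(μ : Measure GStar.{u}) +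
          ∫⁻ z, nbrCount (U \ W) z ∂(μ : Measure GStar.{u})) +
          ∫⁻ z in U \ A, rootDegree z ∂(μ : Measure GStar.{u}) := by
          rw [lintegral_add_right _ (hdm.indicator hUA'),
            lintegral_add_left (hloc K).nbrCount.measurable_natCast, lintegral_indicator hUA']
      _ ≤ (ε + ε) + ε := by
          gcongr
          · exact (hlim.lintegral_nbrCount_le (hloc K).isClopen.isOpen).trans
              ((hdegm (hloc K).measurableSet).trans hK.le)
          · exact (hlim.lintegral_nbrCount_le hUW).trans
              ((hdegm hUW.measurableSet).trans hR.le)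
          · exact (hdegm hUA').trans hUA.le
      _ = 3 * ε := by ring
  exact (hlarge.trans hsmall).not_gt hεc

theorem mainTheorem2 {V : ℕ → Type u} [∀ n, Fintype (V n)] [∀ n, Nonempty (V n)]
    (G : ∀ n, SimpleGraph (V n)) (μ : ProbabilityMeasure GStar.{u}) (d : ℝ)
    (hexp : IsExpanding G) (hdeg : ∀ n, (G n).averageDegree ≤ d)
    (hlim : LocallyWeaklyConverges G μ) :
    ∃ c : ℝ, ∀ᵐ x ∂(μ : Measure GStar.{u}), x.criticalProbability = c := by
  refine exists_eventuallyEq_const_of_forall_separating (· ∈ Set.range (Set.Ioi (α := ℝ))) ?_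
  rintro _ ⟨q, rfl⟩
  have hmeas : MeasurableSet (GStar.criticalProbability.{u} ⁻¹' Set.Ioi q) :=
    measurable_criticalProbability measurableSet_Ioi
  have hinv : IsRerootInvariant (GStar.criticalProbability.{u} ⁻¹' Set.Ioi q) :=
    fun x v _ hx => hx
  rcases zero_one_of_isRerootInvariant hexp hdeg hlim hmeas hinv with h | h
  · exact Or.inr (measure_eq_zero_iff_ae_notMem.1 h)
  · exact Or.inl ((prob_compl_eq_zero_iff hmeas).2 h)
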